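/- Let $G$ be a finite simple graph. The distance between two edges of $G$ is the distance between the corresponding vertices of the line graph of $G$ (so adjacent edges are at distance $1$, and two non-adjacent edges are at distance $2$ exactly when some edge is adjacent to both). A strong edge-coloring of $G$ is an assignment of colors to the edges such that any two distinct edges at distance at most $2$ receive distinct colors. The graph $G$ is strong $k$-edge-choosable if, for every assignment of a list $L(e)$ of colors with $|L(e)|\ge k$ to each edge $e$ of $G$, there is a strong edge-coloring $\varphi$ of $G$ with $\varphi(e)\in L(e)$ for every edge $e$. The list strong chromatic index $\mathrm{ch}_s'(G)$ is the least $k$ such that $G$ is strong $k$-edge-choosable. Theorem. Every finite simple graph $G$ with maximum degree at most $3$ satisfies $$\mathrm{ch}_s'(G)\le 10,$$ that is, $G$ is strong $10$-edge-choosable. The bound is tight: there is a finite simple graph $H$ of maximum degree at most $3$ with $\mathrm{ch}_s'(H)=10$. -/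

import Mathlib

universe u v

namespace SimpleGraph

variable {V : Type u}

/-- A strong edge-coloring of `G` with colors in `C`: distinct edges at distance at most `2` get
distinct colors, where the distance of two edges is their distance in the line graph of `G`
(infinite when they lie in different components). Adjacent edges are at distance `1`, so such a
coloring is in particular proper. -/
def IsStrongEdgeColoring (G : SimpleGraph V) {C : Type v} (φ : G.edgeSet → C) : Prop :=
  ∀ e f : G.edgeSet, e ≠ f → G.lineGraph.edist e f ≤ 2 → φ e ≠ φ f

/-- `G` is strong `L`-edge-colorable: it has a strong edge-coloring that takes the color of each
edge `e` from the list `L e`. -/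
def StrongListEdgeColorable (G : SimpleGraph V) {C : Type v} (L : G.edgeSet → Set C) : Prop :=
  ∃ φ : G.edgeSet → C, G.IsStrongEdgeColoring φ ∧ ∀ e, φ e ∈ L e

/-- `G` is strong `k`-edge-choosable: it is strong `L`-edge-colorable for every list assignment
`L`, over any set of colors, all of whose lists have at least `k` elements. -/
def StrongEdgeChoosable (G : SimpleGraph V) (k : ℕ) : Prop :=
  ∀ (C : Type v) (L : G.edgeSet → Set C),
    (∀ e, (k : ℕ∞) ≤ (L e).encard) → G.StrongListEdgeColorable L

/-- The list strong chromatic index: the least `k` such that `G` is strong `k`-edge-choosable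
(`⊤` if there is no such `k`). -/
noncomputable def listStrongChromaticIndex (G : SimpleGraph V) : ℕ∞ :=
  ⨅ k ∈ {k : ℕ | StrongEdgeChoosable.{u, v} G k}, (k : ℕ∞)

end SimpleGraph

/-!
# Subcubic graphs are strong `10`-edge-choosable

Two edges *conflict* if they share a vertex or are joined by an edge. In a graph of maximum degree
at most `3` an edge has at most `12` conflicts. Let `G` be connected and `S` a nonempty set of
vertices. The edges that miss `S` can be colored greedily by decreasing distance to `S`: an edge
off `S` has a neighboring vertex nearer to `S`, whose edges are all colored later, so that at most
`9` colors are forbidden when its turn comes (`intChoosable_of_root`). There remain the edges that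
meet `S`. Each of them has lost at most as many colors as it has conflicts with edges that miss
`S`, and the question is whether the remaining list coloring problem for a known small graph, the
conflict graph of the edges that meet `S`, can be solved. This follows from the Combinatorial
Nullstellensatz if some monomial with small exponents has a nonzero coefficient in the graph
polynomial `∏ (X u - X v)`. The coefficient is a signed number of orientations with prescribed
out-degrees (`exists_coloring_of_orientSum_ne_zero`), and it is computed by orienting one edge
after the other, where formal sums of the remaining degrees are kept, encoded as numbers in base
`16` (`exists_coloring_of_orientCheck`).

If `G` cannot be colored, then it is cubic, since a vertex of degree at most `2` serves as `S`
(`intChoosable_of_degree_lt`). Taking for `S` some vertices of an induced subgraph of `G`, all of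
whose neighbors belong to it, one excludes the triangle, the three graphs that consist of a
`4`-cycle and a path of length `2` or `3` that joins two of its vertices, and the cycles of length
`4`, `5` and `6`, in this order. If the vertices of an induced subgraph still have neighbors
outside, one distinguishes all ways in which such a neighbor is attached (`Free.of_children`), and
drops those that contain an excluded graph.

So a shortest cycle of `G` has length `g ≥ 7`. Take for `S` its vertices. The edges that meet `S`
are the `g` edges of the cycle, with at least six colors left, and the `g` edges that leave it,
with at least four. No further adjacencies are possible among the ends of these edges, as these
would close a shorter cycle. Hence the conflict graph is a cyclic strip of `2 * g` vertices where
conflicts join vertices at cyclic distance at most `4`. Processing the strip period by period, the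
formal sum of remaining degrees becomes stationary (`periodStep_stable`), and so finitely many
computations show that it is colorable for all `g` (`exists_coloring_cyclicStrip`).

The bound `10` is attained by the `5`-cycle with two adjacent vertices doubled, whose ten edges
conflict pairwise.
-/

namespace StrongEdge

open Finset

/-! ### Signed orientation sums and the Combinatorial Nullstellensatz -/

/-- `decr o u` lowers the value of `o` at `u` by one. -/
def decr {α : Type*} [DecidableEq α] (o : α → ℕ) (u : α) : α → ℕ :=
  Function.update o u (o u - 1)

/-- The signed number of orientations of the edge list `es` in which every vertex `y` owns `o y`
edges and is the non-owning end of `i y` edges. An edge `(u, v)` owned by `v` contributes the sign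
`-1`. The base case does not look at `o` and `i`; it is only used where `o y + i y` is the degree of
`y`, and then both are zero once the edges are used up. -/
def orientSum {α : Type*} [DecidableEq α] : List (α × α) → (α → ℕ) → (α → ℕ) → ℤ
  | [], _, _ => 1
  | (u, v) :: es, o, i =>
    (if 0 < o u ∧ 0 < i v then orientSum es (decr o u) (decr i v) else 0) -
      (if 0 < o v ∧ 0 < i u then orientSum es (decr o v) (decr i u) else 0)

/-- The number of edges of the list `es` at the vertex `y`. -/
def edgeCount {α : Type*} [DecidableEq α] (es : List (α × α)) (y : α) : ℕ :=
  es.countP fun e => e.1 == y || e.2 == y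

lemma edgeCount_cons {α : Type*} [DecidableEq α] (e : α × α) (es : List (α × α)) (y : α) :
    edgeCount (e :: es) y = edgeCount es y + if e.1 = y ∨ e.2 = y then 1 else 0 := by
  simp [edgeCount, List.countP_cons]

section Coeff

open MvPolynomial

variable {α : Type*}

lemma coeff_X_sub_X_mul [DecidableEq α] [Finite α] (u v : α) (o : α → ℕ) (P : MvPolynomial α ℤ) :
    coeff (Finsupp.equivFunOnFinite.symm o) ((X u - X v) * P) =
      (if 0 < o u then coeff (Finsupp.equivFunOnFinite.symm (decr o u)) P else 0) -
      (if 0 < o v then coeff (Finsupp.equivFunOnFinite.symm (decr o v)) P else 0) := by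
  have key : ∀ w, coeff (Finsupp.equivFunOnFinite.symm o) (X w * P) =
      if 0 < o w then coeff (Finsupp.equivFunOnFinite.symm (decr o w)) P else 0 := by
    intro w
    rw [coeff_X_mul']
    have h1 : w ∈ (Finsupp.equivFunOnFinite.symm o).support ↔ 0 < o w := by
      simp [Nat.pos_iff_ne_zero]
    have h2 : Finsupp.equivFunOnFinite.symm o - Finsupp.single w 1 =
        Finsupp.equivFunOnFinite.symm (decr o w) := by
      ext y
      by_cases hy : y = w
      · subst hy; simp [decr]
      · simp [decr, hy]
    simp only [h1, h2]
  rw [sub_mul, coeff_sub, key, key]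

/-- The graph polynomial of an edge list, the product of all `X u - X v`. -/
noncomputable def graphPoly (es : List (α × α)) : MvPolynomial α ℤ :=
  (es.map fun e => X e.1 - X e.2).prod

lemma coeff_graphPoly_eq_zero [DecidableEq α] [Finite α] (es : List (α × α)) (o : α → ℕ) (y : α)
    (h : edgeCount es y < o y) : coeff (Finsupp.equivFunOnFinite.symm o) (graphPoly es) = 0 := by
  induction es generalizing o with
  | nil =>
    have : (Finsupp.equivFunOnFinite.symm o) ≠ 0 := fun h0 => by
      have := DFunLike.congr_fun h0 y
      simp at this
      omega
    simp [graphPoly, coeff_one, this.symm]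
  | cons e es ih =>
    obtain ⟨u, v⟩ := e
    rw [edgeCount_cons] at h
    have hstep : ∀ w, w = u ∨ w = v → edgeCount es y < decr o w y := by
      intro w hw
      by_cases hy : y = w
      · subst hy
        have : u = y ∨ v = y := hw.imp Eq.symm Eq.symm
        simp only [this, if_true] at h
        simp only [decr, Function.update_self]
        omega
      · simp only [decr, Function.update_of_ne hy]
        omega
    have : graphPoly ((u, v) :: es) = (X u - X v) * graphPoly es := by simp [graphPoly]
    rw [this, coeff_X_sub_X_mul, ih _ (hstep u (Or.inl rfl)), ih _ (hstep v (Or.inr rfl))]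
    simp

/-- The coefficient of a monomial in the graph polynomial is the signed number of orientations
with the corresponding out-degrees. -/
lemma coeff_graphPoly [DecidableEq α] [Finite α] (es : List (α × α))
    (hes : ∀ e ∈ es, e.1 ≠ e.2) (o i : α → ℕ)
    (h : ∀ y, o y + i y = edgeCount es y) :
    coeff (Finsupp.equivFunOnFinite.symm o) (graphPoly es) = orientSum es o i := by
  induction es generalizing o i with
  | nil =>
    have : Finsupp.equivFunOnFinite.symm o = 0 := by
      ext y
      have := h y
      simp [edgeCount] at this
      simp [this.1]
    simp [graphPoly, orientSum, this]
  | cons e es ih =>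
    obtain ⟨u, v⟩ := e
    have huv : u ≠ v := hes (u, v) (by simp)
    have half : ∀ a b, (a = u ∧ b = v ∨ a = v ∧ b = u) →
        (if 0 < o a then coeff (Finsupp.equivFunOnFinite.symm (decr o a)) (graphPoly es) else 0) =
        if 0 < o a ∧ 0 < i b then orientSum es (decr o a) (decr i b) else 0 := by
      intro a b hab
      have hne : a ≠ b := by rcases hab with ⟨rfl, rfl⟩ | ⟨rfl, rfl⟩ <;> [exact huv; exact huv.symm]
      have hy : ∀ y, o y + i y = edgeCount es y + if a = y ∨ b = y then 1 else 0 := by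
        intro y
        rw [h y, edgeCount_cons]
        rcases hab with ⟨rfl, rfl⟩ | ⟨rfl, rfl⟩ <;> simp [or_comm]
      by_cases ha : 0 < o a
      · by_cases hb : 0 < i b
        · rw [if_pos ha, if_pos ⟨ha, hb⟩]
          refine ih (fun e he => hes e (List.mem_cons_of_mem _ he)) _ _ fun y => ?_
          have := hy y
          by_cases h1 : y = a
          · subst h1
            simp only [decr, Function.update_self, Function.update_of_ne hne, true_or, if_true] at *
            omega
          · by_cases h2 : y = b
            · subst h2
              simp only [decr, Function.update_self, Function.update_of_ne h1, or_true,
                if_true] at *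
              omega
            · simp only [decr, Function.update_of_ne h1, Function.update_of_ne h2] at *
              simpa [Ne.symm h1, Ne.symm h2] using this
        · rw [if_pos ha, if_neg fun hh => hb hh.2]
          apply coeff_graphPoly_eq_zero es _ b
          have := hy b
          simp only [decr, Function.update_of_ne hne.symm, or_true, if_true] at *
          omega
      · rw [if_neg ha, if_neg fun hh => ha hh.1]
    have : graphPoly ((u, v) :: es) = (X u - X v) * graphPoly es := by simp [graphPoly]
    rw [this, coeff_X_sub_X_mul, half u v (Or.inl ⟨rfl, rfl⟩), half v u (Or.inr ⟨rfl, rfl⟩),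
      orientSum]

lemma totalDegree_graphPoly [Finite α] (es : List (α × α)) (t : α →₀ ℕ)
    (ht : coeff t (graphPoly es) ≠ 0) : (graphPoly es).totalDegree = t.degree := by
  have hom : (graphPoly es).IsHomogeneous es.length := by
    clear ht
    induction es with
    | nil => simpa [graphPoly] using isHomogeneous_one α ℤ
    | cons e es ih =>
      have : graphPoly (e :: es) = (X e.1 - X e.2) * graphPoly es := by simp [graphPoly]
      rw [this, List.length_cons, add_comm]
      exact ((isHomogeneous_X ℤ e.1).sub (isHomogeneous_X ℤ e.2)).mul ih
  have h0 : graphPoly es ≠ 0 := fun h => ht (by simp [h])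
  rw [hom.totalDegree h0, Finsupp.degree_eq_weight_one]
  exact (hom ht).symm

end Coeff

lemma orientSum_map {α β : Type*} [DecidableEq α] [DecidableEq β] (f : α → β)
    (hf : Function.Injective f) (es : List (α × α)) (o i : β → ℕ) :
    orientSum (es.map (Prod.map f f)) o i = orientSum es (o ∘ f) (i ∘ f) := by
  induction es generalizing o i with
  | nil => simp [orientSum]
  | cons e es ih =>
    obtain ⟨u, v⟩ := e
    have h : ∀ (g : β → ℕ) w, decr g (f w) ∘ f = decr (g ∘ f) w := fun g w => by
      simp [decr, Function.update_comp_eq_of_injective _ hf]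
    simp only [List.map_cons, Prod.map_apply, orientSum, Function.comp_apply, ih, h]

/-- List coloring by the Combinatorial Nullstellensatz: if the signed number of orientations with
out-degrees `o` is nonzero, then the graph with edge list `es` can be colored from any lists with
more than `o y` colors at `y`. -/
theorem exists_coloring_of_orientSum_ne_zero {m : ℕ} {es : List (ℕ × ℕ)}
    (hes : ∀ e ∈ es, e.1 < m ∧ e.2 < m ∧ e.1 ≠ e.2) {o i : ℕ → ℕ}
    (h : ∀ y < m, o y + i y = edgeCount es y) (hne : orientSum es o i ≠ 0)
    (S : ℕ → Finset ℤ) (hS : ∀ y < m, o y < #(S y)) :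
    ∃ x : ℕ → ℤ, (∀ y < m, x y ∈ S y) ∧ ∀ e ∈ es, x e.1 ≠ x e.2 := by
  obtain ⟨es', rfl⟩ : ∃ es' : List (Fin m × Fin m), es = es'.map (Prod.map Fin.val Fin.val) := by
    clear h hne
    induction es with
    | nil => exact ⟨[], rfl⟩
    | cons e es ih =>
      obtain ⟨es', h'⟩ := ih fun e he => hes e (List.mem_cons_of_mem _ he)
      have he := hes e (by simp)
      exact ⟨(⟨e.1, he.1⟩, ⟨e.2, he.2.1⟩) :: es', by simp [h']⟩
  have hcount : ∀ y : Fin m, edgeCount (es'.map (Prod.map Fin.val Fin.val)) (y : ℕ) =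
      edgeCount es' y := by
    intro y
    rw [edgeCount, edgeCount, List.countP_map]
    congr 1
    ext e
    rw [Bool.eq_iff_iff]
    simp [Fin.ext_iff]
  rw [orientSum_map _ Fin.val_injective] at hne
  have hne' : ∀ e ∈ es', e.1 ≠ e.2 := by
    intro e he heq
    exact (hes _ (List.mem_map_of_mem he)).2.2 (by simp [heq])
  rw [← coeff_graphPoly es' hne' _ _ fun y => by
    rw [Function.comp_apply, Function.comp_apply, h y y.2, hcount]] at hne
  obtain ⟨s, hs, hs'⟩ := MvPolynomial.combinatorial_nullstellensatz_exists_eval_nonzero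
    (graphPoly es') _ hne (totalDegree_graphPoly es' _ hne) (fun y => S y) (fun y => by
      simpa using hS y y.2)
  refine ⟨fun y => if hy : y < m then s ⟨y, hy⟩ else 0, fun y hy => by simpa [hy] using hs ⟨y, hy⟩,
    ?_⟩
  intro e he
  obtain ⟨e', he', rfl⟩ := List.mem_map.1 he
  intro heq
  apply hs'
  rw [graphPoly, map_list_prod]
  apply List.prod_eq_zero
  rw [List.map_map]
  refine List.mem_map.2 ⟨e', he', ?_⟩
  simpa [sub_eq_zero] using heq

/-! ### Computing orientation sums -/

/-- The digit of `s` at position `j` in base `16`. -/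
def digit (s j : ℕ) : ℕ := s / 16 ^ j % 16

lemma digit_sub_pow {s a : ℕ} (h : 0 < digit s a) (j : ℕ) :
    digit (s - 16 ^ a) j = if j = a then digit s a - 1 else digit s j := by
  unfold digit at *
  obtain ⟨q, r, hr, rfl⟩ : ∃ q r, r < 16 ^ a ∧ s = 16 ^ a * q + r :=
    ⟨s / 16 ^ a, s % 16 ^ a, Nat.mod_lt _ (by positivity), (Nat.div_add_mod _ _).symm⟩
  have hdiv : ∀ q, (16 ^ a * q + r) / 16 ^ a = q := fun q => by
    rw [Nat.mul_add_div (by positivity), Nat.div_eq_of_lt hr, add_zero]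
  rw [hdiv] at h
  obtain ⟨q, rfl⟩ : ∃ q', q = q' + 1 := ⟨q - 1, by
    have : q ≠ 0 := by rintro rfl; simp at h
    omega⟩
  have hs : 16 ^ a * (q + 1) + r - 16 ^ a = 16 ^ a * q + r := by
    rw [mul_add, mul_one]; omega
  rw [hs]
  split_ifs with hj
  · subst hj
    rw [hdiv, hdiv]
    omega
  · rcases lt_or_gt_of_ne hj with hj | hj
    · obtain ⟨d, rfl⟩ : ∃ d, a = j + 1 + d := ⟨a - (j + 1), by omega⟩
      have : ∀ q, (16 ^ (j + 1 + d) * q + r) / 16 ^ j % 16 = r / 16 ^ j % 16 := fun q => by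
        rw [show 16 ^ (j + 1 + d) * q + r = 16 ^ j * (16 * (16 ^ d * q)) + r by ring,
          Nat.mul_add_div (by positivity), Nat.mul_add_mod]
      rw [this, this]
    · obtain ⟨d, rfl⟩ : ∃ d, j = a + 1 + d := ⟨j - (a + 1), by omega⟩
      have : ∀ q, (16 ^ a * q + r) / 16 ^ (a + 1 + d) = q / 16 / 16 ^ d := fun q => by
        rw [pow_add, pow_add, pow_one, ← Nat.div_div_eq_div_mul, ← Nat.div_div_eq_div_mul, hdiv]
      rw [this, this]
      have : q / 16 = (q + 1) / 16 := by omega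
      rw [this]

/-- Adds two formal sums of keys, given as lists sorted by key. The first argument is fuel. -/
def mergeTerms : ℕ → List (ℕ × ℤ) → List (ℕ × ℤ) → List (ℕ × ℤ)
  | 0, l, l' => l ++ l'
  | _ + 1, [], l' => l'
  | _ + 1, l, [] => l
  | n + 1, (s, z) :: l, (t, w) :: l' =>
    bif Nat.blt s t then (s, z) :: mergeTerms n l ((t, w) :: l')
    else bif Nat.blt t s then (t, w) :: mergeTerms n ((s, z) :: l) l'
    else bif z + w == 0 then mergeTerms n l l' else (s, z + w) :: mergeTerms n l l'

/-- Gives an edge to register `u` as the owner and to register `v` as the other end, in every term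
where `u` has out-degree and `v` has in-degree left. -/
def orientTerms (u v : ℕ) (sgn : ℤ) : List (ℕ × ℤ) → List (ℕ × ℤ)
  | [] => []
  | (s, z) :: l =>
    bif Nat.blt 0 (digit s (2 * u)) && Nat.blt 0 (digit s (2 * v + 1)) then
      (s - 16 ^ (2 * u) - 16 ^ (2 * v + 1), sgn * z) :: orientTerms u v sgn l
    else orientTerms u v sgn l

/-- Orients one edge in both ways. -/
def orientStep (st : List (ℕ × ℤ)) (e : ℕ × ℕ) : List (ℕ × ℤ) :=
  mergeTerms (2 * st.length) (orientTerms e.1 e.2 1 st) (orientTerms e.2 e.1 (-1) st)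

/-- The out-degree of the vertex `y` prescribed by the key `s`: the digit `2 * r` of `s` if `y` sits
in register `r`, and `rest y` if it has no register. -/
def outDeg (pos : ℕ → Option ℕ) (rest : ℕ → ℕ) (s y : ℕ) : ℕ :=
  (pos y).elim (rest y) fun r => digit s (2 * r)

/-- The in-degree of the vertex `y` prescribed by the key `s`: the digit `2 * r + 1` of `s` if `y`
sits in register `r`, and `rest y` if it has no register. -/
def inDeg (pos : ℕ → Option ℕ) (rest : ℕ → ℕ) (s y : ℕ) : ℕ :=
  (pos y).elim (rest y) fun r => digit s (2 * r + 1)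

/-- The orientation sum of a formal sum of keys. -/
def stateSum (pos : ℕ → Option ℕ) (rest : ℕ → ℕ) (es : List (ℕ × ℕ)) (st : List (ℕ × ℤ)) : ℤ :=
  (st.map fun t => t.2 * orientSum es (outDeg pos rest t.1) (inDeg pos rest t.1)).sum

lemma sum_mergeTerms (f : ℕ → ℤ) (n : ℕ) (l l' : List (ℕ × ℤ)) :
    ((mergeTerms n l l').map fun t => t.2 * f t.1).sum =
      (l.map fun t => t.2 * f t.1).sum + (l'.map fun t => t.2 * f t.1).sum := by
  induction n generalizing l l' with
  | zero => simp [mergeTerms]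
  | succ n ih =>
    rcases l with _ | ⟨⟨s, z⟩, l⟩
    · simp [mergeTerms]
    rcases l' with _ | ⟨⟨t, w⟩, l'⟩
    · simp [mergeTerms]
    simp only [mergeTerms, Bool.cond_eq_ite, Nat.blt_eq, beq_iff_eq]
    split_ifs with h1 h2 h3
    · simp only [List.map_cons, List.sum_cons, ih]; ring
    · simp only [List.map_cons, List.sum_cons, ih]; ring
    · obtain rfl : s = t := by omega
      obtain rfl : z = -w := by omega
      simp only [List.map_cons, List.sum_cons, ih]; ring
    · obtain rfl : s = t := by omega
      simp only [List.map_cons, List.sum_cons, ih]; ring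

section

variable {pos : ℕ → Option ℕ} (hpos : ∀ y y' r, pos y = some r → pos y' = some r → y = y')
  {rest : ℕ → ℕ}
include hpos

lemma outDeg_sub {y u v s : ℕ} (hu : pos y = some u) (hs : 0 < digit s (2 * u))
    (hs' : 0 < digit s (2 * v + 1)) :
    outDeg pos rest (s - 16 ^ (2 * u) - 16 ^ (2 * v + 1)) = decr (outDeg pos rest s) y := by
  have hs'' : 0 < digit (s - 16 ^ (2 * u)) (2 * v + 1) := by
    rw [digit_sub_pow hs, if_neg (by omega)]; exact hs'
  ext y'
  by_cases h : y' = y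
  · subst h
    simp only [outDeg, decr, hu, digit_sub_pow hs'', digit_sub_pow hs, Option.elim_some, if_true,
      Function.update_self]
    rw [if_neg (by omega)]
  · rw [decr, Function.update_of_ne h]
    rcases h' : pos y' with _ | r
    · simp [outDeg, h']
    · have hr : r ≠ u := fun hr => h (hpos _ _ r h' (hr ▸ hu))
      simp only [outDeg, h', Option.elim_some, digit_sub_pow hs'', digit_sub_pow hs]
      rw [if_neg (by omega), if_neg (by omega)]

lemma inDeg_sub {y u v s : ℕ} (hv : pos y = some v) (hs : 0 < digit s (2 * u))
    (hs' : 0 < digit s (2 * v + 1)) :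
    inDeg pos rest (s - 16 ^ (2 * u) - 16 ^ (2 * v + 1)) = decr (inDeg pos rest s) y := by
  have hs'' : 0 < digit (s - 16 ^ (2 * u)) (2 * v + 1) := by
    rw [digit_sub_pow hs, if_neg (by omega)]; exact hs'
  ext y'
  by_cases h : y' = y
  · subst h
    simp only [inDeg, decr, hv, digit_sub_pow hs'', digit_sub_pow hs, Option.elim_some, if_true,
      Function.update_self]
    rw [if_neg (by omega)]
  · rw [decr, Function.update_of_ne h]
    rcases h' : pos y' with _ | r
    · simp [inDeg, h']
    · have hr : r ≠ v := fun hr => h (hpos _ _ r h' (hr ▸ hv))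
      simp only [inDeg, h', Option.elim_some, digit_sub_pow hs'', digit_sub_pow hs]
      rw [if_neg (by omega), if_neg (by omega)]

lemma sum_orientTerms {y y' u v : ℕ} (hu : pos y = some u) (hv : pos y' = some v) (sgn : ℤ)
    (es : List (ℕ × ℕ)) (st : List (ℕ × ℤ)) :
    stateSum pos rest es (orientTerms u v sgn st) =
      sgn * (st.map fun t => t.2 * if 0 < outDeg pos rest t.1 y ∧ 0 < inDeg pos rest t.1 y' then
        orientSum es (decr (outDeg pos rest t.1) y) (decr (inDeg pos rest t.1) y') else 0).sum := by
  induction st with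
  | nil => simp [orientTerms, stateSum]
  | cons t st ih =>
    obtain ⟨s, z⟩ := t
    have ho : outDeg pos rest s y = digit s (2 * u) := by simp [outDeg, hu]
    have hi : inDeg pos rest s y' = digit s (2 * v + 1) := by simp [inDeg, hv]
    simp only [orientTerms, Bool.cond_eq_ite, Bool.and_eq_true, Nat.blt_eq, List.map_cons,
      List.sum_cons, ho, hi]
    split_ifs with h
    · simp only [stateSum, List.map_cons, List.sum_cons] at ih ⊢
      rw [ih, outDeg_sub hpos hu h.1 h.2, inDeg_sub hpos hv h.1 h.2]
      ring
    · rw [ih]; ring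

lemma stateSum_cons {y y' u v : ℕ} (hu : pos y = some u) (hv : pos y' = some v)
    (es : List (ℕ × ℕ)) (st : List (ℕ × ℤ)) :
    stateSum pos rest ((y, y') :: es) st = stateSum pos rest es (orientStep st (u, v)) := by
  have h := sum_mergeTerms (fun s => orientSum es (outDeg pos rest s) (inDeg pos rest s))
    (2 * st.length) (orientTerms u v 1 st) (orientTerms v u (-1) st)
  have h1 := sum_orientTerms (rest := rest) hpos hu hv 1 es st
  have h2 := sum_orientTerms (rest := rest) hpos hv hu (-1) es st
  unfold stateSum at h1 h2
  unfold stateSum orientStep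
  rw [h, h1, h2, one_mul, neg_one_mul, ← sub_eq_add_neg]
  clear h h1 h2
  induction st with
  | nil => simp
  | cons t st ih =>
    simp only [List.map_cons, List.sum_cons, ih]
    rw [orientSum]
    ring

/-- Processing an initial segment of the edge list, whose vertices sit in registers. -/
lemma stateSum_append {es rs : List (ℕ × ℕ)}
    (h : es.map (Prod.map pos pos) = rs.map (Prod.map some some)) (es' : List (ℕ × ℕ))
    (st : List (ℕ × ℤ)) :
    stateSum pos rest (es ++ es') st = stateSum pos rest es' (rs.foldl orientStep st) := by
  induction es generalizing rs st with
  | nil =>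
    obtain rfl : rs = [] := by simpa using h.symm
    rfl
  | cons e es ih =>
    cases rs with
    | nil => simp at h
    | cons r rs =>
      simp only [List.map_cons, List.cons.injEq, Prod.ext_iff, Prod.map_fst, Prod.map_snd] at h
      rw [List.cons_append, List.foldl_cons, ← ih h.2]
      exact stateSum_cons hpos h.1.1 h.1.2 _ _

end

/-- The sum of the coefficients of a formal sum of keys. -/
def total (st : List (ℕ × ℤ)) : ℤ := (st.map Prod.snd).sum

lemma stateSum_nil (pos : ℕ → Option ℕ) (rest : ℕ → ℕ) (st : List (ℕ × ℤ)) :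
    stateSum pos rest [] st = total st := by
  simp [stateSum, total, orientSum]

/-- The key whose registers `q, q + 1, …` have the out-degrees listed in `a` and the complementary
in-degrees in the graph with edge list `es`. -/
def keyOf (es : List (ℕ × ℕ)) : ℕ → List ℕ → ℕ
  | _, [] => 0
  | q, a :: l => a * 16 ^ (2 * q) + (edgeCount es q - a) * 16 ^ (2 * q + 1) + keyOf es (q + 1) l

/-- A computable certificate that the graph on `{0, …, m - 1}` with edge list `es` can be colored
from any lists with more than `a[y]` colors at `y`. -/
def orientCheck (m : ℕ) (es : List (ℕ × ℕ)) (a : List ℕ) : Bool :=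
  let s := keyOf es 0 a
  (es.all fun e => Nat.blt e.1 m && Nat.blt e.2 m && !Nat.beq e.1 e.2) &&
    (List.range m).all (fun y => Nat.beq (digit s (2 * y)) (a.getD y 0) &&
      Nat.beq (digit s (2 * y) + digit s (2 * y + 1)) (edgeCount es y)) &&
    total (es.foldl orientStep [(s, 1)]) != 0

theorem exists_coloring_of_orientCheck {m : ℕ} {es : List (ℕ × ℕ)} {a : List ℕ}
    (h : orientCheck m es a = true) (S : ℕ → Finset ℤ) (hS : ∀ y < m, a.getD y 0 < #(S y)) :
    ∃ x : ℕ → ℤ, (∀ y < m, x y ∈ S y) ∧ ∀ e ∈ es, x e.1 ≠ x e.2 := by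
  simp only [orientCheck, Bool.and_eq_true, List.all_eq_true, List.mem_range, Nat.blt_eq,
    Bool.not_eq_true', Nat.beq_eq, bne_iff_ne] at h
  obtain ⟨⟨h1, h2⟩, h3⟩ := h
  have hsum := stateSum_append (pos := some) (rest := 0) (by simp) (es := es) (rs := es) rfl []
    [(keyOf es 0 a, 1)]
  rw [stateSum_nil, List.append_nil] at hsum
  refine exists_coloring_of_orientSum_ne_zero (o := outDeg some 0 (keyOf es 0 a))
    (i := inDeg some 0 (keyOf es 0 a)) (fun e he => ?_) (fun y hy => (h2 y hy).2) ?_ S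
    (fun y hy => ?_)
  · have := h1 e he
    exact ⟨this.1.1, this.1.2, fun heq => by simp [heq] at this⟩
  · rw [← hsum] at h3
    simpa [stateSum] using h3
  · have := (h2 y hy).1
    simpa [outDeg, this] using hS y hy

/-! ### List coloring a long cyclic strip -/

/-- The edges that a new period `b + 3`, `b + 4` of the strip sends to the vertices before it. -/
def periodEdges (b : ℕ) : List (ℕ × ℕ) :=
  [(b + 3, b + 2), (b + 3, b + 1), (b + 3, b), (b + 4, b + 3), (b + 4, b + 2), (b + 4, b + 1),
    (b + 4, b)]

/-- The edges between the last three vertices `b`, `b + 1`, `b + 2` and the first four vertices. -/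
def wrapEdges (b : ℕ) : List (ℕ × ℕ) :=
  [(0, b + 2), (0, b + 1), (0, b), (1, b + 2), (1, b + 1), (1, b), (2, b + 2), (3, b + 2)]

/-- The edges of `n` further periods after the vertex `b + 2`, and the wrap-around edges. -/
def stripEdges : ℕ → ℕ → List (ℕ × ℕ)
  | 0, b => wrapEdges b
  | n + 1, b => periodEdges b ++ stripEdges n (b + 2)

/-- The edges among the first four periods. -/
def initEdges : List (ℕ × ℕ) :=
  [(1, 0), (2, 1), (2, 0), (3, 2), (3, 1), (3, 0)] ++ periodEdges 1 ++ periodEdges 3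

/-- The cyclic strip with `g` periods. Its vertices are `0, …, 2 * g - 1`, and two of them are
adjacent if their cyclic distance is at most `3`, or is `4` and they are odd. -/
def cyclicStrip (g : ℕ) : List (ℕ × ℕ) := initEdges ++ stripEdges (g - 4) 5

/-- The out-degrees prescribed for the vertices after the first four periods: half the degree. -/
def stripRest (y : ℕ) : ℕ := if y % 2 = 1 then 4 else 3

/-- Registers `0` to `3` hold the first four vertices, the next `k` registers the vertices
`b, …, b + k - 1`. -/
def stripPos (k b y : ℕ) : Option ℕ :=
  if y < 4 then some y else if b ≤ y ∧ y < b + k then some (y - b + 4) else none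

lemma stripPos_inj {k b : ℕ} (y y' r : ℕ) (h : stripPos k b y = some r)
    (h' : stripPos k b y' = some r) : y = y' := by
  unfold stripPos at h h'
  split_ifs at h h' <;> simp only [Option.some.injEq] at h h' <;> omega

/-- Puts the two vertices of the next period, with their prescribed degrees, into the registers `7`
and `8`. -/
def loadKey (s : ℕ) : ℕ := s % 16 ^ 14 + (3 + 3 * 16 + 4 * 16 ^ 2 + 4 * 16 ^ 3) * 16 ^ 14

/-- Drops the registers `4` and `5` and moves `6`, `7`, `8` to `4`, `5`, `6`. -/
def unloadKey (s : ℕ) : ℕ := s % 16 ^ 8 + s / 16 ^ 12 % 16 ^ 6 * 16 ^ 8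

/-- Drops the register `4` and moves `5`, `6`, `7` to `4`, `5`, `6`. -/
def unloadInit (s : ℕ) : ℕ := s % 16 ^ 8 + s / 16 ^ 10 % 16 ^ 6 * 16 ^ 8

/-- `periodEdges` in terms of registers. -/
def periodRegs : List (ℕ × ℕ) := [(7, 6), (7, 5), (7, 4), (8, 7), (8, 6), (8, 5), (8, 4)]

/-- `wrapEdges` in terms of registers. -/
def wrapRegs : List (ℕ × ℕ) := [(0, 6), (0, 5), (0, 4), (1, 6), (1, 5), (1, 4), (2, 6), (3, 6)]

/-- The effect of one period on the formal sum of keys. -/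
def periodStep (st : List (ℕ × ℤ)) : List (ℕ × ℤ) :=
  (periodRegs.foldl orientStep (st.map (Prod.map loadKey id))).map (Prod.map unloadKey id)

lemma digit_mod (s : ℕ) {n j : ℕ} (hj : j < n) : digit (s % 16 ^ n) j = digit s j := by
  obtain ⟨d, rfl⟩ : ∃ d, n = j + 1 + d := ⟨n - (j + 1), by omega⟩
  unfold digit
  conv_rhs => rw [← Nat.div_add_mod s (16 ^ (j + 1 + d))]
  rw [show 16 ^ (j + 1 + d) * (s / 16 ^ (j + 1 + d)) =
    16 ^ j * (16 * (16 ^ d * (s / 16 ^ (j + 1 + d)))) by ring,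
    Nat.mul_add_div (by positivity), Nat.mul_add_mod]

lemma digit_div (s k j : ℕ) : digit (s / 16 ^ k) j = digit s (j + k) := by
  rw [digit, digit, Nat.div_div_eq_div_mul, ← pow_add, add_comm k j]

lemma digit_add_mul {a n : ℕ} (ha : a < 16 ^ n) (b j : ℕ) :
    digit (a + b * 16 ^ n) j = if j < n then digit a j else digit b (j - n) := by
  split_ifs with h
  · rw [← digit_mod _ h, Nat.add_mul_mod_self_right, digit_mod _ h]
  · obtain ⟨d, rfl⟩ := Nat.exists_eq_add_of_le (Nat.le_of_not_lt h)
    rw [add_comm n d, ← digit_div, Nat.add_mul_div_right _ _ (by positivity), Nat.div_eq_of_lt ha,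
      zero_add, Nat.add_sub_cancel]

lemma digit_loadKey (s : ℕ) {j : ℕ} (hj : j < 14) : digit (loadKey s) j = digit s j := by
  rw [loadKey, digit_add_mul (Nat.mod_lt _ (by positivity)), if_pos hj, digit_mod _ hj]

lemma digit_loadKey_new (s : ℕ) : digit (loadKey s) 14 = 3 ∧ digit (loadKey s) 15 = 3 ∧
    digit (loadKey s) 16 = 4 ∧ digit (loadKey s) 17 = 4 := by
  have h : ∀ j, 14 ≤ j → digit (loadKey s) j =
      digit (3 + 3 * 16 + 4 * 16 ^ 2 + 4 * 16 ^ 3) (j - 14) := fun j hj => by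
    rw [loadKey, digit_add_mul (Nat.mod_lt _ (by positivity)), if_neg (by omega)]
  rw [h _ le_rfl, h _ (by norm_num), h _ (by norm_num), h _ (by norm_num)]
  decide

lemma digit_unloadKey (s : ℕ) {j : ℕ} (hj : j < 14) :
    digit (unloadKey s) j = digit s (if j < 8 then j else j + 4) := by
  rw [unloadKey, digit_add_mul (Nat.mod_lt _ (by positivity))]
  split_ifs with h
  · rw [digit_mod _ h]
  · rw [digit_mod _ (by omega), digit_div]
    congr 1
    omega

lemma digit_unloadInit (s : ℕ) {j : ℕ} (hj : j < 14) :
    digit (unloadInit s) j = digit s (if j < 8 then j else j + 2) := by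
  rw [unloadInit, digit_add_mul (Nat.mod_lt _ (by positivity))]
  split_ifs with h
  · rw [digit_mod _ h]
  · rw [digit_mod _ (by omega), digit_div]
    congr 1
    omega

lemma orientSum_congr {es : List (ℕ × ℕ)} {o o' i i' : ℕ → ℕ}
    (h : ∀ e ∈ es, (o e.1 = o' e.1 ∧ i e.1 = i' e.1) ∧ (o e.2 = o' e.2 ∧ i e.2 = i' e.2)) :
    orientSum es o i = orientSum es o' i' := by
  have key : ∀ (P : ℕ → Prop) (es : List (ℕ × ℕ)), (∀ e ∈ es, P e.1 ∧ P e.2) →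
      ∀ o o' i i' : ℕ → ℕ, (∀ y, P y → o y = o' y ∧ i y = i' y) →
      orientSum es o i = orientSum es o' i' := by
    intro P es
    induction es with
    | nil => intros; rfl
    | cons e es ih =>
      obtain ⟨u, v⟩ := e
      intro hP o o' i i' hoi
      have hu := hoi u (hP (u, v) (by simp)).1
      have hv := hoi v (hP (u, v) (by simp)).2
      have hd : ∀ w w', (w = u ∨ w = v) → (w' = u ∨ w' = v) →
          orientSum es (decr o w) (decr i w') = orientSum es (decr o' w) (decr i' w') := by
        intro w w' hw hw'
        refine ih (fun e he => hP e (List.mem_cons_of_mem _ he)) _ _ _ _ fun y hy => ?_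
        simp only [decr, Function.update_apply]
        have := hoi y hy
        have h1 : o w = o' w := by rcases hw with rfl | rfl <;> [exact hu.1; exact hv.1]
        have h2 : i w' = i' w' := by rcases hw' with rfl | rfl <;> [exact hu.2; exact hv.2]
        rw [h1, h2, this.1, this.2]
        exact ⟨rfl, rfl⟩
      simp only [orientSum, hu, hv, hd u v (.inl rfl) (.inr rfl), hd v u (.inr rfl) (.inl rfl)]
  exact key (fun y => o y = o' y ∧ i y = i' y) es h o o' i i' fun _ h => h

lemma mem_stripEdges {n b : ℕ} {e : ℕ × ℕ} (h : e ∈ stripEdges n b) :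
    (e.1 < 4 ∨ b ≤ e.1) ∧ (e.2 < 4 ∨ b ≤ e.2) := by
  induction n generalizing b with
  | zero =>
    simp only [stripEdges, wrapEdges, List.mem_cons, List.not_mem_nil, or_false] at h
    rcases h with rfl | rfl | rfl | rfl | rfl | rfl | rfl | rfl <;> simp
  | succ n ih =>
    simp only [stripEdges, periodEdges, List.mem_append, List.mem_cons, List.not_mem_nil,
      or_false] at h
    rcases h with (rfl | rfl | rfl | rfl | rfl | rfl | rfl) | h
    all_goals first | (have := ih h; omega) | simp

/-- Change of registers. Keys may be replaced by keys for other registers, if these give the same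
degrees to the vertices of the remaining edges. -/
lemma stateSum_map {pos pos' : ℕ → Option ℕ} {rest : ℕ → ℕ} {es : List (ℕ × ℕ)} (f : ℕ → ℕ)
    (P : ℕ → Prop) (hP : ∀ e ∈ es, P e.1 ∧ P e.2)
    (h : ∀ s y, P y → outDeg pos' rest (f s) y = outDeg pos rest s y ∧
      inDeg pos' rest (f s) y = inDeg pos rest s y) (st : List (ℕ × ℤ)) :
    stateSum pos' rest es (st.map (Prod.map f id)) = stateSum pos rest es st := by
  unfold stateSum
  rw [List.map_map]
  congr 1
  refine List.map_congr_left fun t _ => ?_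
  simp only [Function.comp_apply, Prod.map_fst, Prod.map_snd, id_eq]
  rw [orientSum_congr fun e he => ⟨h t.1 e.1 (hP e he).1, h t.1 e.2 (hP e he).2⟩]

lemma degrees_load {b : ℕ} (hodd : b % 2 = 1) {d d' : ℕ → ℕ}
    (hd : ∀ j < 14, d' j = d j) (hn : d' 14 = 3 ∧ d' 15 = 3 ∧ d' 16 = 4 ∧ d' 17 = 4) (y : ℕ) :
    ((stripPos 5 b y).elim (stripRest y) fun r => d' (2 * r)) =
        ((stripPos 3 b y).elim (stripRest y) fun r => d (2 * r)) ∧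
      ((stripPos 5 b y).elim (stripRest y) fun r => d' (2 * r + 1)) =
        ((stripPos 3 b y).elim (stripRest y) fun r => d (2 * r + 1)) := by
  by_cases h1 : y < 4
  · have h2 : ∀ k, stripPos k b y = some y := fun k => if_pos h1
    simp only [h2, Option.elim_some]
    exact ⟨hd _ (by omega), hd _ (by omega)⟩
  by_cases h2 : y < b
  · have h3 : ∀ k, stripPos k b y = none := fun k => by
      rw [stripPos, if_neg h1, if_neg (by omega)]
    simp only [h3, Option.elim_none, and_self]
  obtain ⟨c, rfl⟩ := Nat.exists_eq_add_of_le (Nat.le_of_not_lt h2)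
  have h3 : ∀ k, c < k → stripPos k b (b + c) = some (c + 4) := fun k hk => by
    rw [stripPos, if_neg h1, if_pos (by omega), Nat.add_sub_cancel_left]
  have h4 : ∀ k, k ≤ c → stripPos k b (b + c) = none := fun k hk => by
    rw [stripPos, if_neg h1, if_neg (by omega)]
  rcases Nat.lt_or_ge c 3 with h | h
  · simp only [h3 5 (by omega), h3 3 h, Option.elim_some]
    exact ⟨hd _ (by omega), hd _ (by omega)⟩
  rcases Nat.lt_or_ge c 5 with h' | h'
  · simp only [h3 5 h', h4 3 h, Option.elim_some, Option.elim_none, stripRest]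
    obtain rfl | rfl : c = 3 ∨ c = 4 := by omega
    · rw [if_neg (by omega)]
      exact ⟨hn.1, hn.2.1⟩
    · rw [if_pos (by omega)]
      exact ⟨hn.2.2.1, hn.2.2.2⟩
  · simp only [h4 5 h', h4 3 h, Option.elim_none, and_self]

lemma degrees_unload {b : ℕ} {d d' : ℕ → ℕ}
    (hd : ∀ j < 14, d' j = d (if j < 8 then j else j + 4)) {y : ℕ} (hy : y < 4 ∨ b + 2 ≤ y) :
    ((stripPos 3 (b + 2) y).elim (stripRest y) fun r => d' (2 * r)) =
        ((stripPos 5 b y).elim (stripRest y) fun r => d (2 * r)) ∧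
      ((stripPos 3 (b + 2) y).elim (stripRest y) fun r => d' (2 * r + 1)) =
        ((stripPos 5 b y).elim (stripRest y) fun r => d (2 * r + 1)) := by
  by_cases h1 : y < 4
  · have h2 : ∀ k b, stripPos k b y = some y := fun k b => if_pos h1
    simp only [h2, Option.elim_some]
    rw [hd _ (by omega), hd _ (by omega), if_pos (by omega), if_pos (by omega)]
    exact ⟨rfl, rfl⟩
  obtain ⟨c, rfl⟩ := Nat.exists_eq_add_of_le (hy.resolve_left h1)
  by_cases h2 : c < 3
  · have h3 : stripPos 3 (b + 2) (b + 2 + c) = some (c + 4) := by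
      rw [stripPos, if_neg h1, if_pos (by omega), Nat.add_sub_cancel_left]
    have h4 : stripPos 5 b (b + 2 + c) = some (c + 6) := by
      rw [stripPos, if_neg h1, if_pos (by omega)]
      congr 1
      omega
    simp only [h3, h4, Option.elim_some]
    rw [hd _ (by omega), hd _ (by omega), if_neg (by omega),
      if_neg (by omega), show 2 * (c + 4) + 4 = 2 * (c + 6) by ring,
      show 2 * (c + 4) + 1 + 4 = 2 * (c + 6) + 1 by ring]
    exact ⟨rfl, rfl⟩
  · have h3 : stripPos 3 (b + 2) (b + 2 + c) = none := by
      rw [stripPos, if_neg h1, if_neg (by omega)]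
    have h4 : stripPos 5 b (b + 2 + c) = none := by
      rw [stripPos, if_neg h1, if_neg (by omega)]
    simp only [h3, h4, Option.elim_none, and_self]

lemma stateSum_period {n b : ℕ} (hb : 4 ≤ b) (hodd : b % 2 = 1) (st : List (ℕ × ℤ)) :
    stateSum (stripPos 3 b) stripRest (stripEdges (n + 1) b) st =
      stateSum (stripPos 3 (b + 2)) stripRest (stripEdges n (b + 2)) (periodStep st) := by
  have hload : stateSum (stripPos 5 b) stripRest (stripEdges (n + 1) b)
      (st.map (Prod.map loadKey id)) =
      stateSum (stripPos 3 b) stripRest (stripEdges (n + 1) b) st :=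
    stateSum_map loadKey (fun _ => True) (by simp) (fun s y _ => degrees_load hodd
      (fun j hj => digit_loadKey s hj) (digit_loadKey_new s) y) st
  have hrun : stateSum (stripPos 5 b) stripRest (stripEdges (n + 1) b)
      (st.map (Prod.map loadKey id)) = stateSum (stripPos 5 b) stripRest (stripEdges n (b + 2))
      (periodRegs.foldl orientStep (st.map (Prod.map loadKey id))) := by
    have h1 : ¬ b < 4 := by omega
    have h2 : ∀ c, ¬ b + c < 4 := by omega
    exact stateSum_append stripPos_inj (by simp [periodEdges, periodRegs, stripPos, h1, h2]) _ _
  rw [← hload, hrun, periodStep]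
  symm
  exact stateSum_map unloadKey (fun y => y < 4 ∨ b + 2 ≤ y) (fun e he => mem_stripEdges he)
    (fun s y hy => degrees_unload (fun j hj => digit_unloadKey s hj) hy) _

lemma stateSum_stripEdges (n : ℕ) {b : ℕ} (hb : 4 ≤ b) (hodd : b % 2 = 1) (st : List (ℕ × ℤ)) :
    stateSum (stripPos 3 b) stripRest (stripEdges n b) st =
      total (wrapRegs.foldl orientStep (periodStep^[n] st)) := by
  induction n generalizing b st with
  | zero =>
    have h1 : ¬ b < 4 := by omega
    have h2 : ∀ c, ¬ b + c + 1 < 4 := by omega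
    rw [stripEdges, ← List.append_nil (wrapEdges b), stateSum_append stripPos_inj
      (rs := wrapRegs) (by simp [wrapEdges, wrapRegs, stripPos]; omega), stateSum_nil]
    rfl
  | succ n ih =>
    rw [stateSum_period hb hodd, ih (by omega) (by omega), Function.iterate_succ_apply]

/-- The key that gives the first eight vertices the out-degrees `0, 5, 3, 5, 3, 4, 3, 5` and the
complementary in-degrees in the strip. They are chosen such that the formal sums of keys stay short
and the orientation sum does not vanish. -/
def initKey : ℕ :=
  ([0, 5, 3, 5, 3, 4, 3, 5].zipIdx.map fun a =>
    (a.1 + (2 * stripRest a.2 - a.1) * 16) * 256 ^ a.2).sum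

/-- The formal sum of keys after the first four periods, from the key `s`. -/
def initStateOf (s : ℕ) : List (ℕ × ℤ) :=
  (initEdges.foldl orientStep [(s, 1)]).map (Prod.map unloadInit id)

/-- Registers `0` to `7` hold the first eight vertices. -/
def initPos (y : ℕ) : Option ℕ := if y < 8 then some y else none

lemma degrees_unloadInit {d d' : ℕ → ℕ}
    (hd : ∀ j < 14, d' j = d (if j < 8 then j else j + 2)) {y : ℕ} (hy : y < 4 ∨ 5 ≤ y) :
    ((stripPos 3 5 y).elim (stripRest y) fun r => d' (2 * r)) =
        ((initPos y).elim (stripRest y) fun r => d (2 * r)) ∧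
      ((stripPos 3 5 y).elim (stripRest y) fun r => d' (2 * r + 1)) =
        ((initPos y).elim (stripRest y) fun r => d (2 * r + 1)) := by
  by_cases h1 : y < 4
  · have h2 : stripPos 3 5 y = some y := if_pos h1
    have h3 : initPos y = some y := if_pos (by omega)
    simp only [h2, h3, Option.elim_some]
    rw [hd _ (by omega), hd _ (by omega), if_pos (by omega),
      if_pos (by omega)]
    exact ⟨rfl, rfl⟩
  obtain ⟨c, rfl⟩ := Nat.exists_eq_add_of_le (hy.resolve_left h1)
  by_cases h2 : c < 3
  · have h3 : stripPos 3 5 (5 + c) = some (c + 4) := by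
      rw [stripPos, if_neg h1, if_pos (by omega), Nat.add_sub_cancel_left]
    have h4 : initPos (5 + c) = some (c + 5) := by
      rw [initPos, if_pos (by omega), add_comm]
    simp only [h3, h4, Option.elim_some]
    rw [hd _ (by omega), hd _ (by omega), if_neg (by omega),
      if_neg (by omega), show 2 * (c + 4) + 2 = 2 * (c + 5) by ring,
      show 2 * (c + 4) + 1 + 2 = 2 * (c + 5) + 1 by ring]
    exact ⟨rfl, rfl⟩
  · have h3 : stripPos 3 5 (5 + c) = none := by
      rw [stripPos, if_neg h1, if_neg (by omega)]
    have h4 : initPos (5 + c) = none := by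
      rw [initPos, if_neg (by omega)]
    simp only [h3, h4, Option.elim_none, and_self]

lemma initPos_inj (y y' r : ℕ) (h : initPos y = some r) (h' : initPos y' = some r) : y = y' := by
  unfold initPos at h h'
  split_ifs at h h'
  simp only [Option.some.injEq] at h h'
  omega

lemma stateSum_cyclicStrip (g : ℕ) :
    stateSum initPos stripRest (cyclicStrip g) [(initKey, 1)] =
      total (wrapRegs.foldl orientStep (periodStep^[g - 4] (initStateOf initKey))) := by
  rw [← stateSum_stripEdges (g - 4) (b := 5) (by norm_num) (by norm_num)]
  generalize initKey = s
  rw [cyclicStrip, stateSum_append initPos_inj (rs := initEdges) (by decide)]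
  exact (stateSum_map unloadInit (fun y => y < 4 ∨ 5 ≤ y) (fun e he => mem_stripEdges he)
    (fun s y hy => degrees_unloadInit (fun j hj => digit_unloadInit s hj) hy) _).symm

lemma edgeCount_append (es es' : List (ℕ × ℕ)) (y : ℕ) :
    edgeCount (es ++ es') y = edgeCount es y + edgeCount es' y := by
  simp [edgeCount]

lemma edgeCount_periodEdges (b y : ℕ) :
    edgeCount (periodEdges b) y = if y < b ∨ b + 5 ≤ y then 0 else if y < b + 3 then 2 else 4 := by
  rcases Nat.lt_or_ge y b with h | h
  · rw [if_pos (Or.inl h), edgeCount, List.countP_eq_zero]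
    simp only [periodEdges, List.mem_cons, List.not_mem_nil, or_false]
    rintro e (rfl | rfl | rfl | rfl | rfl | rfl | rfl) <;> simp <;> omega
  obtain ⟨c, rfl⟩ := Nat.exists_eq_add_of_le h
  rcases Nat.lt_or_ge c 5 with h | h
  · interval_cases c <;> simp [edgeCount, periodEdges]
  · rw [if_pos (Or.inr (by omega)), edgeCount, List.countP_eq_zero]
    simp only [periodEdges, List.mem_cons, List.not_mem_nil, or_false]
    rintro e (rfl | rfl | rfl | rfl | rfl | rfl | rfl) <;> simp <;> omega

lemma edgeCount_wrapEdges {b : ℕ} (hb : 4 ≤ b) (y : ℕ) :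
    edgeCount (wrapEdges b) y =
      if y < 2 then 3 else if y < 4 then 1 else if y = b ∨ y = b + 1 then 2
      else if y = b + 2 then 4 else 0 := by
  obtain ⟨b, rfl⟩ := Nat.exists_eq_add_of_le hb
  have h1 : ∀ k < 4, ¬ 4 + b = k ∧ ¬ k = 4 + b := by omega
  have h2 := h1 0 (by norm_num)
  have h3 := h1 1 (by norm_num)
  have h4 := h1 2 (by norm_num)
  have h5 := h1 3 (by norm_num)
  clear h1
  rcases Nat.lt_or_ge y (4 + b) with h | h
  · rcases Nat.lt_or_ge y 4 with h' | h'
    · interval_cases y <;> simp [edgeCount, wrapEdges, h3, h4, h5]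
    · rw [if_neg (by omega), if_neg (by omega), if_neg (by omega), if_neg (by omega), edgeCount,
        List.countP_eq_zero]
      simp only [wrapEdges, List.mem_cons, List.not_mem_nil, or_false]
      rintro e (rfl | rfl | rfl | rfl | rfl | rfl | rfl | rfl) <;> simp <;> omega
  obtain ⟨c, rfl⟩ := Nat.exists_eq_add_of_le h
  have h6 : ¬ 4 + b + c < 2 := by omega
  have h7 : ¬ 4 + b + c < 4 := by omega
  rcases Nat.lt_or_ge c 3 with h | h
  · rw [if_neg h6, if_neg h7]
    clear h6 h7
    interval_cases c <;> simp [edgeCount, wrapEdges, h2, h3, h4, h5]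
  · rw [if_neg (by omega), if_neg (by omega), if_neg (by omega), if_neg (by omega), edgeCount,
      List.countP_eq_zero]
    simp only [wrapEdges, List.mem_cons, List.not_mem_nil, or_false]
    rintro e (rfl | rfl | rfl | rfl | rfl | rfl | rfl | rfl) <;> simp <;> omega

lemma edgeCount_stripEdges (n : ℕ) {b : ℕ} (hb : 4 ≤ b) (hodd : b % 2 = 1) (y : ℕ) :
    edgeCount (stripEdges n b) y =
      if y < 4 then (if y < 2 then 3 else 1) else if y < b then 0 else if y ≤ b + 1 then 2
      else if y = b + 2 then 4 else if y < b + 3 + 2 * n then 2 * stripRest y else 0 := by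
  induction n generalizing b with
  | zero =>
    rw [stripEdges, edgeCount_wrapEdges hb]
    split_ifs <;> omega
  | succ n ih =>
    rw [stripEdges, edgeCount_append, ih (by omega) (by omega), edgeCount_periodEdges]
    rcases Nat.lt_or_ge y b with h | h
    · rw [if_pos (Or.inl h)]
      split_ifs <;> omega
    obtain ⟨c, rfl⟩ := Nat.exists_eq_add_of_le h
    have h1 : ¬ b + c < 4 := by omega
    have h2 : ¬ b + c < b := by omega
    rcases Nat.lt_or_ge c 5 with h | h
    · rw [if_neg (by omega), if_neg h1, if_neg h1, if_neg h2]
      have h4 : stripRest (b + 3) = 3 := if_neg (by omega)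
      have h5 : stripRest (b + 4) = 4 := if_pos (by omega)
      interval_cases c
      all_goals simp [h4, h5]
      all_goals omega
    · rw [if_pos (Or.inr (by omega))]
      split_ifs <;> omega

/-- After the first nine periods, the formal sum of keys stays the same, so that a single
computation covers all long strips. -/
lemma periodStep_stable :
    periodStep^[6] (initStateOf initKey) = periodStep^[5] (initStateOf initKey) := by
  decide +kernel

lemma total_strip_ne_zero (n : ℕ) (hn : 3 ≤ n) :
    total (wrapRegs.foldl orientStep (periodStep^[n] (initStateOf initKey))) ≠ 0 := by
  have h3 : total (wrapRegs.foldl orientStep (periodStep^[3] (initStateOf initKey))) ≠ 0 := by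
    decide +kernel
  have h4 : total (wrapRegs.foldl orientStep (periodStep^[4] (initStateOf initKey))) ≠ 0 := by
    decide +kernel
  have h5 : total (wrapRegs.foldl orientStep (periodStep^[5] (initStateOf initKey))) ≠ 0 := by
    decide +kernel
  have hst : ∀ k, periodStep^[5 + k] (initStateOf initKey) =
      periodStep^[5] (initStateOf initKey) := by
    intro k
    induction k with
    | zero => rfl
    | succ k ih =>
      rw [← add_assoc, Function.iterate_succ_apply', ih,
        ← Function.iterate_succ_apply' periodStep 5]
      exact periodStep_stable
  rcases Nat.lt_or_ge n 5 with h | h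
  · interval_cases n
    · exact h3
    · exact h4
  · obtain ⟨k, rfl⟩ := Nat.exists_eq_add_of_le h
    rw [hst]
    exact h5

theorem exists_coloring_cyclicStrip {g : ℕ} (hg : 7 ≤ g) (S : ℕ → Finset ℤ)
    (hS : ∀ y < 2 * g, (if y % 2 = 1 then 6 else 4) ≤ #(S y)) :
    ∃ x : ℕ → ℤ, (∀ y < 2 * g, x y ∈ S y) ∧ ∀ e ∈ cyclicStrip g, x e.1 ≠ x e.2 := by
  have hdigit : ∀ y < 8, digit initKey (2 * y) ≤ (if y % 2 = 1 then 5 else 3) ∧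
      digit initKey (2 * y) + digit initKey (2 * y + 1) = 2 * stripRest y := by decide +kernel
  have hinit : ∀ y < 8, edgeCount initEdges y + (if y < 4 then (if y < 2 then 3 else 1) else
      if y < 5 then 0 else if y ≤ 6 then 2 else 4) = 2 * stripRest y := by decide
  have hinit' : ∀ y, 8 ≤ y → edgeCount initEdges y = 0 := by
    intro y hy
    rw [edgeCount, List.countP_eq_zero]
    have : ∀ e ∈ initEdges, e.1 < 8 ∧ e.2 < 8 := by decide
    intro e he
    have := this e he
    simp
    omega
  have hmem : ∀ (n b : ℕ), 4 ≤ b → ∀ e ∈ stripEdges n b,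
      e.1 < b + 3 + 2 * n ∧ e.2 < b + 3 + 2 * n ∧ e.1 ≠ e.2 := by
    intro n
    induction n with
    | zero =>
      intro b hb e he
      simp only [stripEdges, wrapEdges, List.mem_cons, List.not_mem_nil, or_false] at he
      rcases he with rfl | rfl | rfl | rfl | rfl | rfl | rfl | rfl <;> simp <;> omega
    | succ n ih =>
      intro b hb e he
      rw [stripEdges, List.mem_append] at he
      rcases he with he | he
      · simp only [periodEdges, List.mem_cons, List.not_mem_nil, or_false] at he
        rcases he with rfl | rfl | rfl | rfl | rfl | rfl | rfl <;> simp <;> omega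
      · have := ih (b + 2) (by omega) e he
        omega
  refine exists_coloring_of_orientSum_ne_zero (m := 2 * g) (o := outDeg initPos stripRest initKey)
    (i := inDeg initPos stripRest initKey) (fun e he => ?_) (fun y hy => ?_) ?_ S (fun y hy => ?_)
  · rw [cyclicStrip, List.mem_append] at he
    rcases he with he | he
    · have : ∀ e ∈ initEdges, e.1 < 8 ∧ e.2 < 8 ∧ e.1 ≠ e.2 := by decide
      have := this e he
      omega
    · have := hmem _ _ (by norm_num) e he
      omega
  · rw [cyclicStrip, edgeCount_append, edgeCount_stripEdges _ (by norm_num) (by norm_num)]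
    by_cases h : y < 8
    · simp only [outDeg, inDeg, initPos, h, if_true, Option.elim_some]
      rw [(hdigit y h).2, ← hinit y h]
      split_ifs <;> omega
    · simp only [outDeg, inDeg, initPos, h, if_false, Option.elim_none]
      rw [hinit' y (by omega)]
      split_ifs <;> omega
  · have := total_strip_ne_zero (g - 4) (by omega)
    rw [← stateSum_cyclicStrip] at this
    simpa [stateSum] using this
  · have := hS y hy
    by_cases h : y < 8
    · simp only [outDeg, initPos, h, if_true, Option.elim_some]
      have := (hdigit y h).1
      split_ifs at * <;> omega
    · simp only [outDeg, initPos, h, if_false, Option.elim_none, stripRest]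
      split_ifs at * <;> omega

/-- Adjacency in the cyclic strip, by the difference of the two vertices. -/
lemma mem_cyclicStrip {g y z : ℕ} (hg : 7 ≤ g) (hy : y < 2 * g) (hz : z < 2 * g)
    (h : y = z + 1 ∨ y = z + 2 ∨ y = z + 3 ∨ (y = z + 4 ∧ z % 2 = 1) ∨
      y + 2 * g = z + 1 ∨ y + 2 * g = z + 2 ∨ y + 2 * g = z + 3 ∨
      (y + 2 * g = z + 4 ∧ z % 2 = 1)) : (y, z) ∈ cyclicStrip g := by
  have hstrip : ∀ (n b : ℕ), 4 ≤ b → b % 2 = 1 → ∀ y z, b + 3 ≤ y → y < b + 3 + 2 * n →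
      (y = z + 1 ∨ y = z + 2 ∨ y = z + 3 ∨ (y = z + 4 ∧ z % 2 = 1)) →
      (y, z) ∈ stripEdges n b := by
    intro n
    induction n with
    | zero => intro b hb hodd y z h1 h2; omega
    | succ n ih =>
      intro b hb hodd y z h1 h2 h
      rw [stripEdges, List.mem_append]
      by_cases h3 : b + 2 + 3 ≤ y
      · exact Or.inr (ih (b + 2) (by omega) (by omega) y z h3 (by omega) h)
      · left
        simp only [periodEdges, List.mem_cons, Prod.mk.injEq, List.not_mem_nil, or_false]
        omega
  have hwrap : ∀ (n b y z : ℕ), (y, z) ∈ wrapEdges (b + 2 * n) → (y, z) ∈ stripEdges n b := by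
    intro n
    induction n with
    | zero => intro b y z h; exact h
    | succ n ih =>
      intro b y z h
      rw [stripEdges, List.mem_append]
      refine Or.inr (ih (b + 2) y z ?_)
      rwa [show b + 2 + 2 * n = b + 2 * (n + 1) by ring]
  rw [cyclicStrip, List.mem_append]
  by_cases h1 : y + 2 * g ≤ z + 4
  · right
    apply hwrap
    simp only [wrapEdges, List.mem_cons, Prod.mk.injEq, List.not_mem_nil, or_false]
    omega
  by_cases h2 : 8 ≤ y
  · right
    exact hstrip _ _ (by norm_num) (by norm_num) y z (by omega) (by omega) (by omega)
  · left
    have hz : z < 8 := by omega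
    have : y < 8 := by omega
    have key : ∀ y < 8, ∀ z < 8, (y = z + 1 ∨ y = z + 2 ∨ y = z + 3 ∨ (y = z + 4 ∧ z % 2 = 1)) →
        (y, z) ∈ initEdges := by
      intro y hy z hz h
      interval_cases y <;> interval_cases z <;> first | omega | decide
    exact key y this z hz (by omega)

/-! ### Coloring the edges far from a root set -/

section Conflict

variable {V : Type u}

/-- Two distinct edges conflict if they share a vertex or some edge joins them: these are the pairs
of edges at distance at most `2`. -/
def Conf (G : SimpleGraph V) (e f : Sym2 V) : Prop :=
  e ≠ f ∧ ∃ a ∈ e, ∃ b ∈ f, a = b ∨ G.Adj a b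

instance [Fintype V] [DecidableEq V] (G : SimpleGraph V) [DecidableRel G.Adj] :
    DecidableRel (Conf G) := fun e f =>
  inferInstanceAs (Decidable (e ≠ f ∧ ∃ a, a ∈ e ∧ ∃ b, b ∈ f ∧ (a = b ∨ G.Adj a b)))

lemma Conf.symm {G : SimpleGraph V} {e f : Sym2 V} (h : Conf G e f) : Conf G f e := by
  obtain ⟨hne, a, ha, b, hb, hab⟩ := h
  exact ⟨hne.symm, b, hb, a, ha, hab.imp Eq.symm SimpleGraph.Adj.symm⟩

/-- The edges of `G` in `F` can be colored from the lists `L` such that conflicting edges get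
different colors. -/
def ColorableOn (G : SimpleGraph V) (F : Set (Sym2 V)) (L : Sym2 V → Finset ℤ) : Prop :=
  ∃ x : Sym2 V → ℤ, ∀ e ∈ G.edgeSet, e ∈ F → x e ∈ L e ∧
    ∀ f ∈ G.edgeSet, f ∈ F → Conf G e f → x e ≠ x f

/-- The graph `G` is strong `10`-edge-choosable for lists of integers. -/
def IntChoosable (G : SimpleGraph V) : Prop :=
  ∀ L : Sym2 V → Finset ℤ, (∀ e ∈ G.edgeSet, 10 ≤ #(L e)) → ColorableOn G Set.univ L

/-- An edge in conflict with `s(a, b)` contains a neighbor of `a` or `b` other than `a` and `b`. -/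
lemma Conf.exists_neighbor {G : SimpleGraph V} {a b : V} {f : Sym2 V} (hab : G.Adj a b)
    (hf : f ∈ G.edgeSet) (h : Conf G s(a, b) f) :
    ∃ z ∈ f, z ≠ a ∧ z ≠ b ∧ (G.Adj a z ∨ G.Adj b z) := by
  obtain ⟨hne, c, hc, d, hd, hcd⟩ := h
  have hc : c = a ∨ c = b := by simpa using hc
  by_cases hd' : d = a ∨ d = b
  · obtain ⟨z, rfl⟩ := Sym2.mem_iff_exists.1 hd
    rw [SimpleGraph.mem_edgeSet] at hf
    refine ⟨z, by simp, ?_⟩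
    rcases hd' with rfl | rfl
    · exact ⟨hf.ne', fun h => hne (by rw [h]), Or.inl hf⟩
    · exact ⟨fun h => hne (by rw [h, Sym2.eq_swap]), hf.ne', Or.inr hf⟩
  · push Not at hd'
    refine ⟨d, hd, hd'.1, hd'.2, ?_⟩
    rcases hc with rfl | rfl
    · exact Or.inl (hcd.resolve_left fun h => hd'.1 h.symm)
    · exact Or.inr (hcd.resolve_left fun h => hd'.2 h.symm)

end Conflict

section Greedy

variable {V : Type u} [Fintype V] [DecidableEq V] {G : SimpleGraph V} [DecidableRel G.Adj]

/-- Greedy coloring in the order of decreasing rank `R`: when `e` gets its color, only edges of at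
least the same rank are colored. -/
lemma colorableOn_of_rank (R : Sym2 V → ℕ) (A : Finset (Sym2 V)) (L : Sym2 V → Finset ℤ)
    (h : ∀ e ∈ A, #{f ∈ A | Conf G e f ∧ R e ≤ R f} < #(L e)) : ColorableOn G A L := by
  suffices ∀ B ⊆ A, ∃ x : Sym2 V → ℤ, ∀ e ∈ B, x e ∈ L e ∧ ∀ f ∈ B, Conf G e f → x e ≠ x f by
    obtain ⟨x, hx⟩ := this A subset_rfl
    exact ⟨x, fun e _ he => ⟨(hx e he).1, fun f _ hf => (hx e he).2 f hf⟩⟩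
  intro B
  induction B using Finset.induction_on_min_value R with
  | empty => exact fun _ => ⟨0, by simp⟩
  | insert a s ha hmin ih =>
    intro hs
    obtain ⟨x, hx⟩ := ih ((subset_insert _ _).trans hs)
    have hcard : #(image x {f ∈ s | Conf G a f}) < #(L a) := by
      refine (card_image_le.trans (card_le_card fun f hf => ?_)).trans_lt (h a (hs (by simp)))
      rw [mem_filter] at hf ⊢
      exact ⟨hs (mem_insert_of_mem hf.1), hf.2, hmin f hf.1⟩
    obtain ⟨c, hc, hc'⟩ := exists_mem_notMem_of_card_lt_card hcard
    have hca : ∀ f ∈ s, Conf G a f → c ≠ x f := fun f hf hconf hcx =>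
      hc' (mem_image.2 ⟨f, mem_filter.2 ⟨hf, hconf⟩, hcx.symm⟩)
    have hupd : ∀ f ∈ s, Function.update x a c f = x f := fun f hf =>
      Function.update_of_ne (by rintro rfl; exact ha hf) _ _
    refine ⟨Function.update x a c, fun e he => ?_⟩
    rcases mem_insert.1 he with rfl | he'
    · refine ⟨by simpa using hc, fun f hf hconf => ?_⟩
      have hf : f ∈ s := (mem_insert.1 hf).resolve_left fun h => hconf.1 h.symm
      rw [hupd f hf, Function.update_self]
      exact hca f hf hconf
    · refine ⟨by rw [hupd e he']; exact (hx e he').1, fun f hf hconf => ?_⟩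
      rw [hupd e he']
      rcases mem_insert.1 hf with rfl | hf
      · rw [Function.update_self]
        exact (hca e he' hconf.symm).symm
      · rw [hupd f hf]
        exact (hx e he').2 f hf hconf

lemma card_biUnion_incidence_le (hdeg : ∀ v, G.degree v ≤ 3) (T : Finset V) (F : Finset (Sym2 V))
    (hF : ∀ f ∈ F, f ∈ G.edgeSet ∧ ∃ z ∈ T, z ∈ f) : #F ≤ 3 * #T := by
  have : F ⊆ T.biUnion fun v => G.incidenceFinset v := fun f hf => by
    obtain ⟨h, z, hz, hzf⟩ := hF f hf
    exact mem_biUnion.2 ⟨z, hz, by simpa [SimpleGraph.incidenceSet] using ⟨h, hzf⟩⟩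
  calc #F ≤ #(T.biUnion fun v => G.incidenceFinset v) := card_le_card this
    _ ≤ #T * 3 := card_biUnion_le_card_mul _ _ _ fun v _ => by
        rw [SimpleGraph.card_incidenceFinset_eq_degree]; exact hdeg v
    _ = 3 * #T := mul_comm _ _

/-- In a connected graph of maximum degree at most `3`, the edges that miss the nonempty vertex set
`S` can be colored first, by decreasing distance to `S`: if `u` is the end of an edge `e` nearer to
`S` and `w` is a neighbor of `u` nearer still, then the edges at `w` are colored after `e`, and at
most nine edges in conflict with `e` are colored before it. It remains to color the edges that
meet `S`. -/
theorem intChoosable_of_root (hG : G.Connected) (hdeg : ∀ v, G.degree v ≤ 3) {S : Finset V}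
    (hS : S.Nonempty)
    (h : ∀ L : Sym2 V → Finset ℤ, (∀ e ∈ G.edgeSet, (∃ s ∈ S, s ∈ e) →
      10 ≤ #(L e) + #{f ∈ G.edgeFinset | Conf G e f ∧ ∀ s ∈ S, s ∉ f}) →
      ColorableOn G {e | ∃ s ∈ S, s ∈ e} L) : IntChoosable G := by
  intro L hL
  set δ : V → ℕ := fun v => S.inf' hS (G.dist v) with hδ
  have hδ0 : ∀ v, δ v = 0 → v ∈ S := fun v hv => by
    obtain ⟨s, hs, hs'⟩ := exists_mem_eq_inf' hS (G.dist v)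
    rw [hδ] at hv
    simp only at hv
    rw [hv] at hs'
    rwa [(hG.dist_eq_zero_iff).1 hs'.symm]
  have hstep : ∀ v, v ∉ S → ∃ w, G.Adj v w ∧ δ w < δ v := fun v hv => by
    obtain ⟨s, hs, hs'⟩ := exists_mem_eq_inf' hS (G.dist v)
    obtain ⟨p, hp⟩ := hG.exists_walk_length_eq_dist v s
    cases p with
    | nil => exact absurd hs hv
    | cons hvw p =>
      refine ⟨_, hvw, ?_⟩
      calc δ _ ≤ G.dist _ s := inf'_le _ hs
        _ ≤ p.length := SimpleGraph.dist_le p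
        _ < δ v := by
          rw [hδ]
          simp only
          rw [hs', ← hp, SimpleGraph.Walk.length_cons]
          exact Nat.lt_succ_self _
  let R : Sym2 V → ℕ := fun e => (Sym2.map δ e).inf
  have hR : ∀ a b, R s(a, b) = min (δ a) (δ b) := fun a b => by simp [R]
  have hRmem : ∀ e, ∀ z ∈ e, R e ≤ δ z := fun e z hz => by
    obtain ⟨y, rfl⟩ := Sym2.mem_iff_exists.1 hz
    rw [hR]
    exact min_le_left _ _
  set A : Finset (Sym2 V) := {f ∈ G.edgeFinset | ∀ s ∈ S, s ∉ f} with hA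
  have memA : ∀ e, e ∈ A ↔ e ∈ G.edgeSet ∧ ∀ s ∈ S, s ∉ e := fun e => by
    rw [hA, mem_filter, SimpleGraph.mem_edgeFinset]
  have hfar : ∀ e ∈ A, #{f ∈ A | Conf G e f ∧ R e ≤ R f} < #(L e) := by
    intro e he
    rw [memA] at he
    refine lt_of_lt_of_le ?_ (hL e he.1)
    obtain ⟨u, b, rfl, hub⟩ : ∃ u b, e = s(u, b) ∧ R e = δ u := by
      induction e with | h a b => ?_
      rcases le_total (δ a) (δ b) with hab | hab
      · exact ⟨a, b, rfl, by rw [hR, min_eq_left hab]⟩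
      · exact ⟨b, a, Sym2.eq_swap, by rw [hR, min_eq_right hab]⟩
    have hadj : G.Adj u b := he.1
    obtain ⟨w, hw, hlt⟩ := hstep u fun hu => he.2 u hu (by simp)
    have hwb : w ≠ b := by
      rintro rfl
      have := hRmem s(u, w) w (by simp)
      omega
    have hcardT : #(((G.neighborFinset u).erase b).erase w ∪ (G.neighborFinset b).erase u) ≤ 3 := by
      refine (card_union_le _ _).trans ?_
      rw [card_erase_of_mem (by simp [hwb, hw]), card_erase_of_mem (by simpa using hadj),
        card_erase_of_mem (by simpa using hadj.symm), SimpleGraph.card_neighborFinset_eq_degree,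
        SimpleGraph.card_neighborFinset_eq_degree]
      have h1 := hdeg u
      have h2 := hdeg b
      omega
    have := card_biUnion_incidence_le hdeg
      (((G.neighborFinset u).erase b).erase w ∪ (G.neighborFinset b).erase u)
      {f ∈ A | Conf G s(u, b) f ∧ R s(u, b) ≤ R f} fun f hf => by
        rw [mem_filter, memA] at hf
        obtain ⟨hfA, hconf, hrank⟩ := hf
        refine ⟨hfA.1, ?_⟩
        obtain ⟨z, hz, hzu, hzb, hz'⟩ := hconf.exists_neighbor hadj hfA.1
        refine ⟨z, ?_, hz⟩
        have hzw : z ≠ w := by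
          rintro rfl
          have := hRmem f z hz
          omega
        simpa [hzu, hzb, hzw] using hz'
    omega
  obtain ⟨y, hy⟩ := colorableOn_of_rank R A L hfar
  obtain ⟨x, hx⟩ := h (fun e => L e \ image y {f ∈ G.edgeFinset | Conf G e f ∧ ∀ s ∈ S, s ∉ f})
    fun e he _ => (hL e he).trans <| by
      have h1 := le_card_sdiff (image y {f ∈ G.edgeFinset | Conf G e f ∧ ∀ s ∈ S, s ∉ f}) (L e)
      have h2 := card_image_le (s := {f ∈ G.edgeFinset | Conf G e f ∧ ∀ s ∈ S, s ∉ f}) (f := y)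
      omega
  classical
  refine ⟨fun e => if ∃ s ∈ S, s ∈ e then x e else y e, fun e he _ => ?_⟩
  have notA : ∀ f ∈ G.edgeSet, (¬ ∃ s ∈ S, s ∈ f) → f ∈ A := fun f hf h => by
    rw [memA]; push Not at h; exact ⟨hf, h⟩
  have cross : ∀ e f, e ∈ G.edgeSet → f ∈ G.edgeSet → (∃ s ∈ S, s ∈ e) → (¬ ∃ s ∈ S, s ∈ f) →
      Conf G e f → x e ≠ y f := fun e f he hf h1 h2 hconf heq => by
    have := (mem_sdiff.1 (hx e he h1).1).2
    refine this (mem_image.2 ⟨f, mem_filter.2 ⟨by simpa using hf, hconf, ?_⟩, heq.symm⟩)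
    push Not at h2; exact h2
  by_cases h1 : ∃ s ∈ S, s ∈ e
  · simp only [h1, if_true]
    refine ⟨(mem_sdiff.1 (hx e he h1).1).1, fun f hf _ hconf => ?_⟩
    by_cases h2 : ∃ s ∈ S, s ∈ f
    · simp only [h2, if_true]
      exact (hx e he h1).2 f hf h2 hconf
    · simp only [h2, if_false]
      exact cross e f he hf h1 h2 hconf
  · simp only [h1, if_false]
    refine ⟨(hy e he (notA e he h1)).1, fun f hf _ hconf => ?_⟩
    by_cases h2 : ∃ s ∈ S, s ∈ f
    · simp only [h2, if_true]
      exact (cross f e hf he h2 h1 hconf.symm).symm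
    · simp only [h2, if_false]
      exact (hy e he (notA e he h1)).2 f hf (notA f hf h2) hconf

end Greedy

/-! ### Reducible configurations -/

/-- Adjacency of `i` and `j` in the graph with edge list `E`. -/
def adjOf (E : List (ℕ × ℕ)) (i j : ℕ) : Bool :=
  E.any fun e => (Nat.beq e.1 i && Nat.beq e.2 j) || (Nat.beq e.1 j && Nat.beq e.2 i)

lemma adjOf_iff {E : List (ℕ × ℕ)} {i j : ℕ} : adjOf E i j = true ↔ (i, j) ∈ E ∨ (j, i) ∈ E := by
  simp only [adjOf, List.any_eq_true, Bool.or_eq_true, Bool.and_eq_true, Nat.beq_eq]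
  constructor
  · rintro ⟨⟨a, b⟩, he, ⟨rfl, rfl⟩ | ⟨rfl, rfl⟩⟩
    · exact Or.inl he
    · exact Or.inr he
  · rintro (h | h)
    · exact ⟨_, h, Or.inl ⟨rfl, rfl⟩⟩
    · exact ⟨_, h, Or.inr ⟨rfl, rfl⟩⟩

lemma adjOf_comm (E : List (ℕ × ℕ)) (i j : ℕ) : adjOf E i j = adjOf E j i := by
  rw [Bool.eq_iff_iff, adjOf_iff, adjOf_iff, or_comm]

/-- The map `φ` embeds the graph on `{0, …, n - 1}` with edge list `E` into `G` as an induced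
subgraph. -/
def IsInduced {V : Type u} (G : SimpleGraph V) (n : ℕ) (E : List (ℕ × ℕ)) (φ : ℕ → V) : Prop :=
  ∀ i < n, ∀ j < n, (φ i = φ j → i = j) ∧ (G.Adj (φ i) (φ j) ↔ adjOf E i j = true)

/-- The degree of `i` in the graph on `{0, …, n - 1}` with edge list `E`. -/
def degOf (n : ℕ) (E : List (ℕ × ℕ)) (i : ℕ) : ℕ := (List.range n).countP (adjOf E i)

/-- Membership of `i` in the list `S`. -/
def memOf (S : List ℕ) (i : ℕ) : Bool := S.any (Nat.beq i)

lemma memOf_iff {S : List ℕ} {i : ℕ} : memOf S i = true ↔ i ∈ S := by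
  simp [memOf, Nat.beq_eq]

/-- An upper bound for the number of edges of `G` at the image of `x` that miss the image of `S`. -/
def freeOf (n : ℕ) (E : List (ℕ × ℕ)) (S : List ℕ) (x : ℕ) : ℕ :=
  3 - (List.range n).countP fun s => memOf S s && adjOf E x s

/-- An upper bound for the number of neighbors outside the configuration of the image of `x`, where
`S` are vertices all of whose neighbors belong to the configuration. -/
def openOf (n : ℕ) (E : List (ℕ × ℕ)) (S : List ℕ) (x : ℕ) : ℕ :=
  bif memOf S x then 0 else 3 - degOf n E x

/-- An upper bound for the number of edges of `G` that conflict with the image of `e` and miss the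
image of `S`. -/
def outBound (n : ℕ) (E : List (ℕ × ℕ)) (S : List ℕ) (e : ℕ × ℕ) : ℕ :=
  ((List.range n).map fun x => bif !memOf S x && !Nat.beq x e.1 && !Nat.beq x e.2 &&
    (adjOf E e.1 x || adjOf E e.2 x) then freeOf n E S x else 0).sum +
    3 * (openOf n E S e.1 + openOf n E S e.2)

/-- Some end of `e` is equal or adjacent to some end of `f`, in the graph with edge list `E`. -/
def closeOf (E : List (ℕ × ℕ)) (e f : ℕ × ℕ) : Bool :=
  (Nat.beq e.1 f.1 || adjOf E e.1 f.1) || (Nat.beq e.1 f.2 || adjOf E e.1 f.2) ||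
    ((Nat.beq e.2 f.1 || adjOf E e.2 f.1) || (Nat.beq e.2 f.2 || adjOf E e.2 f.2))

/-- The pairs `p < q` of positions of conflicting edges in the list `U`. -/
def conflictsOf (E U : List (ℕ × ℕ)) : List (ℕ × ℕ) :=
  (List.range U.length).flatMap fun q =>
    ((List.range q).filter fun p => closeOf E (U.getD p (0, 0)) (U.getD q (0, 0))).map fun p =>
      (p, q)

lemma mem_conflictsOf {E U : List (ℕ × ℕ)} {p q : ℕ} : (p, q) ∈ conflictsOf E U ↔
    q < U.length ∧ p < q ∧ closeOf E (U.getD p (0, 0)) (U.getD q (0, 0)) = true := by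
  simp only [conflictsOf, List.mem_flatMap, List.mem_map, List.mem_filter, List.mem_range,
    Prod.mk.injEq]
  constructor
  · rintro ⟨q', hq, p', ⟨hp, hc⟩, rfl, rfl⟩
    exact ⟨hq, hp, hc⟩
  · rintro ⟨hq, hp, hc⟩
    exact ⟨q, hq, p, ⟨hp, hc⟩, rfl, rfl⟩

/-- A computable certificate that an induced subgraph with edge list `E` on `{0, …, n - 1}` is
reducible, provided that it contains all neighbors of the vertices of `S`: `U` lists the edges that
meet the root set `S`, which can be colored last by the Combinatorial Nullstellensatz with the
exponents `a`. -/
def configCheck (n : ℕ) (E : List (ℕ × ℕ)) (S : List ℕ) (U : List (ℕ × ℕ)) (a : List ℕ) : Bool :=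
  !S.isEmpty &&
  (S.all fun s => Nat.blt s n && (List.range n).all fun j => !adjOf E s j || adjOf U s j) &&
  (U.all fun e => Nat.blt e.1 n && Nat.blt e.2 n && adjOf E e.1 e.2 &&
    (memOf S e.1 || memOf S e.2)) &&
  ((List.range U.length).all fun q =>
    Nat.blt (a.getD q 0 + outBound n E S (U.getD q (0, 0))) 10) &&
  orientCheck U.length (conflictsOf E U) a

lemma card_filter_range_eq_countP (n : ℕ) (p : ℕ → Bool) :
    #{x ∈ range n | p x = true} = (List.range n).countP p := by
  rw [List.countP_eq_length_filter]
  simp only [Finset.card, Finset.filter, Finset.range, Multiset.range, Multiset.filter_coe,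
    Multiset.coe_card, Bool.decide_eq_true]

section Configuration

variable {V : Type u} [Fintype V] [DecidableEq V] {G : SimpleGraph V} [DecidableRel G.Adj]
  {n : ℕ} {E : List (ℕ × ℕ)} {φ : ℕ → V}

lemma card_free_le (hdeg : ∀ v, G.degree v ≤ 3) (hφ : IsInduced G n E φ) {S : List ℕ}
    {x : ℕ} (hx : x < n) :
    #{f ∈ G.incidenceFinset (φ x) | ∀ s ∈ S, φ s ∉ f} ≤ freeOf n E S x := by
  set B : Finset ℕ := {s ∈ range n | (memOf S s && adjOf E x s) = true} with hB
  have hBmem : ∀ s, s ∈ B ↔ s < n ∧ s ∈ S ∧ adjOf E x s = true := fun s => by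
    rw [hB, mem_filter, mem_range, Bool.and_eq_true, memOf_iff]
  have h1 : #(B.image fun s => s(φ x, φ s)) = #B := by
    refine card_image_of_injOn fun s hs t ht hst => ?_
    have hs := (hBmem s).1 hs
    have ht := (hBmem t).1 ht
    exact (hφ s hs.1 t ht.1).1 (Sym2.congr_right.1 hst)
  have h2 : Disjoint {f ∈ G.incidenceFinset (φ x) | ∀ s ∈ S, φ s ∉ f}
      (B.image fun s => s(φ x, φ s)) := by
    rw [disjoint_left]
    intro f hf hf'
    obtain ⟨s, hs, rfl⟩ := mem_image.1 hf'
    exact (mem_filter.1 hf).2 s ((hBmem s).1 hs).2.1 (by simp)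
  have h3 : {f ∈ G.incidenceFinset (φ x) | ∀ s ∈ S, φ s ∉ f} ∪
      (B.image fun s => s(φ x, φ s)) ⊆ G.incidenceFinset (φ x) := by
    refine union_subset (filter_subset _ _) fun f hf => ?_
    obtain ⟨s, hs, rfl⟩ := mem_image.1 hf
    have hs := (hBmem s).1 hs
    rw [SimpleGraph.mem_incidenceFinset, SimpleGraph.mk'_mem_incidenceSet_left_iff]
    exact (hφ x hx s hs.1).2.2 hs.2.2
  have h4 := card_le_card h3
  rw [card_union_of_disjoint h2, h1, SimpleGraph.card_incidenceFinset_eq_degree] at h4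
  have h5 := hdeg (φ x)
  have h6 : freeOf n E S x = 3 - #B := by
    rw [hB, card_filter_range_eq_countP]
    rfl
  omega

lemma card_outside_le (hdeg : ∀ v, G.degree v ≤ 3) (hφ : IsInduced G n E φ) {S : List ℕ}
    (hS : ∀ s ∈ S, ∀ w, G.Adj (φ s) w → ∃ j < n, w = φ j) {x : ℕ} (hx : x < n) :
    #(G.neighborFinset (φ x) \ (range n).image φ) ≤ openOf n E S x := by
  unfold openOf
  cases hxS : memOf S x
  · simp only [cond_false]
    have h1 : #(image φ {j ∈ range n | adjOf E x j = true}) = degOf n E x := by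
      rw [degOf, ← card_filter_range_eq_countP]
      refine card_image_of_injOn fun s hs t ht hst => ?_
      exact (hφ s (mem_range.1 (mem_filter.1 hs).1) t (mem_range.1 (mem_filter.1 ht).1)).1 hst
    have h2 : Disjoint (G.neighborFinset (φ x) \ (range n).image φ)
        (image φ {j ∈ range n | adjOf E x j = true}) := by
      rw [disjoint_left]
      intro w hw hw'
      exact (mem_sdiff.1 hw).2 (image_subset_image (filter_subset _ _) hw')
    have h3 : (G.neighborFinset (φ x) \ (range n).image φ) ∪
        (image φ {j ∈ range n | adjOf E x j = true}) ⊆ G.neighborFinset (φ x) := by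
      refine union_subset sdiff_subset fun w hw => ?_
      obtain ⟨j, hj, rfl⟩ := mem_image.1 hw
      rw [mem_filter, mem_range] at hj
      rw [SimpleGraph.mem_neighborFinset]
      exact (hφ x hx j hj.1).2.2 hj.2
    have h4 := card_le_card h3
    rw [card_union_of_disjoint h2, h1, SimpleGraph.card_neighborFinset_eq_degree] at h4
    have := hdeg (φ x)
    omega
  · simp only [cond_true, Nat.le_zero, card_eq_zero, sdiff_eq_empty_iff_subset]
    intro w hw
    obtain ⟨j, hj, rfl⟩ := hS x (memOf_iff.1 hxS) w (by simpa using hw)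
    exact mem_image_of_mem _ (mem_range.2 hj)

lemma card_conf_le (hdeg : ∀ v, G.degree v ≤ 3) (hφ : IsInduced G n E φ) {S : List ℕ}
    (hS : ∀ s ∈ S, ∀ w, G.Adj (φ s) w → ∃ j < n, w = φ j) {e : ℕ × ℕ} (h1 : e.1 < n)
    (h2 : e.2 < n) (he : adjOf E e.1 e.2 = true) :
    #{f ∈ G.edgeFinset | Conf G s(φ e.1, φ e.2) f ∧ ∀ s ∈ S, φ s ∉ f} ≤ outBound n E S e := by
  obtain ⟨a, b⟩ := e
  simp only at h1 h2 he ⊢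
  have hab : G.Adj (φ a) (φ b) := (hφ a h1 b h2).2.2 he
  set X : Finset ℕ := {x ∈ range n | (!memOf S x && !Nat.beq x a && !Nat.beq x b &&
    (adjOf E a x || adjOf E b x)) = true} with hX
  set T : Finset V := (G.neighborFinset (φ a) \ (range n).image φ) ∪
    (G.neighborFinset (φ b) \ (range n).image φ) with hT
  have hsub : {f ∈ G.edgeFinset | Conf G s(φ a, φ b) f ∧ ∀ s ∈ S, φ s ∉ f} ⊆
      (X.biUnion fun x => {f ∈ G.incidenceFinset (φ x) | ∀ s ∈ S, φ s ∉ f}) ∪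
        {f ∈ G.edgeFinset | ∃ z ∈ T, z ∈ f} := by
    intro f hf
    rw [mem_filter, SimpleGraph.mem_edgeFinset] at hf
    obtain ⟨hfG, hconf, hfS⟩ := hf
    obtain ⟨z, hzf, hza, hzb, hz⟩ := hconf.exists_neighbor hab hfG
    rw [mem_union]
    by_cases hzn : z ∈ (range n).image φ
    · left
      obtain ⟨x, hx, rfl⟩ := mem_image.1 hzn
      have hxn := mem_range.1 hx
      refine mem_biUnion.2 ⟨x, ?_, ?_⟩
      · rw [hX, mem_filter]
        refine ⟨hx, ?_⟩
        have h3 : memOf S x = false := by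
          rw [Bool.eq_false_iff, ne_eq, memOf_iff]
          exact fun h => hfS x h hzf
        have h4 : Nat.beq x a = false := by
          rw [Bool.eq_false_iff, ne_eq, Nat.beq_eq]
          rintro rfl
          exact hza rfl
        have h5 : Nat.beq x b = false := by
          rw [Bool.eq_false_iff, ne_eq, Nat.beq_eq]
          rintro rfl
          exact hzb rfl
        rw [(hφ a h1 x hxn).2, (hφ b h2 x hxn).2] at hz
        simpa [h3, h4, h5] using hz
      · rw [mem_filter, SimpleGraph.mem_incidenceFinset]
        exact ⟨⟨hfG, hzf⟩, hfS⟩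
    · right
      rw [mem_filter, SimpleGraph.mem_edgeFinset]
      refine ⟨hfG, z, ?_, hzf⟩
      simpa [hT, hzn] using hz
  have hcardT := card_biUnion_incidence_le hdeg T {f ∈ G.edgeFinset | ∃ z ∈ T, z ∈ f}
    fun f hf => by simpa using hf
  have hcardX : #(X.biUnion fun x => {f ∈ G.incidenceFinset (φ x) | ∀ s ∈ S, φ s ∉ f}) ≤
      ((List.range n).map fun x => bif !memOf S x && !Nat.beq x a && !Nat.beq x b &&
        (adjOf E a x || adjOf E b x) then freeOf n E S x else 0).sum := by
    calc _ ≤ ∑ x ∈ X, #{f ∈ G.incidenceFinset (φ x) | ∀ s ∈ S, φ s ∉ f} := card_biUnion_le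
      _ ≤ ∑ x ∈ X, freeOf n E S x := by
        refine sum_le_sum fun x hx => ?_
        rw [hX, mem_filter] at hx
        exact card_free_le hdeg hφ (mem_range.1 hx.1)
      _ = _ := by
        rw [hX, sum_filter]
        simp only [Bool.cond_eq_ite]
        rfl
  have h3 := card_outside_le hdeg hφ hS h1
  have h4 := card_outside_le hdeg hφ hS h2
  calc _ ≤ _ := card_le_card hsub
    _ ≤ _ := card_union_le _ _
    _ ≤ _ + 3 * (openOf n E S a + openOf n E S b) :=
      Nat.add_le_add hcardX (hcardT.trans (Nat.mul_le_mul_left 3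
        ((card_union_le _ _).trans (Nat.add_le_add h3 h4))))

theorem intChoosable_of_configCheck (hG : G.Connected) (hdeg : ∀ v, G.degree v ≤ 3)
    (hφ : IsInduced G n E φ) {S : List ℕ} {U : List (ℕ × ℕ)} {a : List ℕ}
    (hS : ∀ s ∈ S, ∀ w, G.Adj (φ s) w → ∃ j < n, w = φ j)
    (h : configCheck n E S U a = true) : IntChoosable G := by
  simp only [configCheck, Bool.and_eq_true, List.all_eq_true, List.mem_range, Nat.blt_eq,
    Bool.not_eq_true', Bool.or_eq_true] at h
  obtain ⟨⟨⟨⟨hne, hSU⟩, hU⟩, ha⟩, hcheck⟩ := h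
  have hUget : ∀ q < U.length, U.getD q (0, 0) ∈ U := fun q hq => by
    rw [List.getD_eq_getElem _ _ hq]
    exact List.getElem_mem hq
  set ψ : ℕ → Sym2 V := fun q => s(φ (U.getD q (0, 0)).1, φ (U.getD q (0, 0)).2) with hψ
  have hψG : ∀ q < U.length, ψ q ∈ G.edgeSet := fun q hq =>
    have := hU _ (hUget q hq)
    (hφ _ this.1.1.1 _ this.1.1.2).2.2 this.1.2
  have hex : ∀ e ∈ G.edgeSet, (∃ s ∈ S, φ s ∈ e) → ∃ q < U.length, ψ q = e := by
    rintro e he ⟨s, hs, hse⟩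
    obtain ⟨w, rfl⟩ := Sym2.mem_iff_exists.1 hse
    obtain ⟨j, hj, rfl⟩ := hS s hs w he
    have hadj := (hφ s (hSU s hs).1 j hj).2.1 he
    have hsj := ((hSU s hs).2 j hj).resolve_left (by simp [hadj])
    rcases adjOf_iff.1 hsj with hm | hm
    · obtain ⟨q, hq, hget⟩ := List.getElem_of_mem hm
      exact ⟨q, hq, by simp only [hψ]; rw [List.getD_eq_getElem _ _ hq, hget]⟩
    · obtain ⟨q, hq, hget⟩ := List.getElem_of_mem hm
      exact ⟨q, hq, by simp only [hψ]; rw [List.getD_eq_getElem _ _ hq, hget, Sym2.eq_swap]⟩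
  have hroot : (image φ S.toFinset).Nonempty := by
    rw [image_nonempty, List.toFinset_nonempty_iff]
    rintro rfl
    simp at hne
  refine intChoosable_of_root hG hdeg hroot fun L hL => ?_
  simp only [mem_image, List.mem_toFinset, exists_exists_and_eq_and, forall_exists_index, and_imp,
    forall_apply_eq_imp_iff₂] at hL
  obtain ⟨x, hx, hxK⟩ := exists_coloring_of_orientCheck hcheck (fun q => L (ψ q)) fun q hq => by
    have h2 := hU _ (hUget q hq)
    obtain ⟨s, hs, hs'⟩ : ∃ s ∈ S, φ s ∈ ψ q := by
      rcases h2.2 with h | h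
      · exact ⟨_, memOf_iff.1 h, by simp [hψ]⟩
      · exact ⟨_, memOf_iff.1 h, by simp [hψ]⟩
    have h1 := hL (ψ q) (hψG q hq) s hs hs'
    have h3 := card_conf_le hdeg hφ hS h2.1.1.1 h2.1.1.2 h2.1.2
    have h4 := ha q hq
    simp only [hψ] at h1 ⊢
    omega
  classical
  choose! idx hidx using hex
  refine ⟨fun e => x (idx e), fun e he heS => ?_⟩
  have hmemS : ∀ e : Sym2 V, e ∈ {e : Sym2 V | ∃ s ∈ image φ S.toFinset, s ∈ e} →
      ∃ s ∈ S, φ s ∈ e := fun e he => by simpa using he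
  obtain ⟨hq, hqe⟩ := hidx e he (hmemS e heS)
  refine ⟨by have := hx _ hq; rwa [hqe] at this, fun f hf hfS hconf => ?_⟩
  obtain ⟨hq', hqf⟩ := hidx f hf (hmemS f hfS)
  have key : ∀ q q', q < U.length → q' < U.length → Conf G (ψ q) (ψ q') → q < q' →
      x q ≠ x q' := by
    intro q q' hq hq' hc hlt
    refine hxK (q, q') (mem_conflictsOf.2 ⟨hq', hlt, ?_⟩)
    obtain ⟨-, c, hc, d, hd, hcd⟩ := hc
    have hq := (hU _ (hUget q hq)).1.1
    have hq' := (hU _ (hUget q' hq')).1.1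
    have near : ∀ i < n, ∀ j < n, φ i = φ j ∨ G.Adj (φ i) (φ j) →
        (Nat.beq i j || adjOf E i j) = true := by
      rintro i hi j hj (h | h)
      · rw [(hφ i hi j hj).1 h]; simp
      · rw [(hφ i hi j hj).2.1 h]; simp
    simp only [hψ, Sym2.mem_iff] at hc hd
    rw [closeOf]
    rcases hc with rfl | rfl <;> rcases hd with rfl | rfl
    · rw [near _ hq.1 _ hq'.1 hcd]; simp
    · rw [near _ hq.1 _ hq'.2 hcd]; simp
    · rw [near _ hq.2 _ hq'.1 hcd]; simp
    · rw [near _ hq.2 _ hq'.2 hcd]; simp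
  rcases lt_trichotomy (idx e) (idx f) with hlt | heq | hlt
  · exact key _ _ hq hq' (by rwa [hqe, hqf]) hlt
  · exact absurd (by rw [← hqe, ← hqf, heq]) hconf.1
  · exact (key _ _ hq' hq (by rw [hqe, hqf]; exact hconf.symm) hlt).symm

end Configuration

/-! ### Excluding induced subgraphs by branching -/

/-- The graph `G` has no induced subgraph with the vertices `0, …, P.1 - 1` and edge list `P.2`. -/
def Free {V : Type u} (G : SimpleGraph V) (P : ℕ × List (ℕ × ℕ)) : Prop :=
  ∀ φ : ℕ → V, ¬ IsInduced G P.1 P.2 φ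

/-- The vertex `x` of the graph on `{0, …, n - 1}` with edge list `E` can be the image of the next
vertex of the graph with edge list `E'`, of which the vertices before have the images `l`. -/
def extendsBy (E E' : List (ℕ × ℕ)) (l : List ℕ) (x : ℕ) : Bool :=
  !adjOf E' l.length l.length && (List.range l.length).reverse.all fun i =>
    !Nat.beq (l.getD i 0) x && (adjOf E (l.getD i 0) x == adjOf E' i l.length)

/-- Searches for `k` further vertices of an induced subgraph with edge list `E'` in the graph on
`{0, …, n - 1}` with edge list `E`, of which the first vertices have the images `l`. -/
def findSubgraph (n : ℕ) (E E' : List (ℕ × ℕ)) : ℕ → List ℕ → Bool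
  | 0, _ => true
  | k + 1, l => (List.range n).any fun x =>
      extendsBy E E' l x && findSubgraph n E E' k (l ++ [x])

/-- Searches for the graph `R` as an induced subgraph of `Q`. If `rooted` is true, the vertex `0` of
`R` has to be the last vertex of `Q`. -/
def hasSubgraph (rooted : Bool) (Q R : ℕ × List (ℕ × ℕ)) : Bool :=
  bif rooted then Nat.blt 0 Q.1 && Nat.blt 0 R.1 && extendsBy Q.2 R.2 [] (Q.1 - 1) &&
    findSubgraph Q.1 Q.2 R.2 (R.1 - 1) [Q.1 - 1]
  else findSubgraph Q.1 Q.2 R.2 R.1 []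

/-- Adds a vertex `n` with the neighbors `v` and `B`. -/
def addVertex (n : ℕ) (E : List (ℕ × ℕ)) (v : ℕ) (B : List ℕ) : List (ℕ × ℕ) :=
  E ++ (v, n) :: B.map fun x => (x, n)

/-- The graphs that can arise from `P` by adding a new neighbor of `v` in a cubic graph, without
those where an induced subgraph from the list `known` is found. The new vertex has at most two
further neighbors `B` in `P`. If `v` has degree `3` already, nothing is added. -/
def children (known : List (ℕ × List (ℕ × ℕ))) (rooted : Bool) (P : ℕ × List (ℕ × ℕ)) (v : ℕ) :
    List (ℕ × List (ℕ × ℕ)) :=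
  bif Nat.blt v P.1 && Nat.blt (degOf P.1 P.2 v) 3 &&
    P.2.all (fun e => Nat.blt e.1 P.1 && Nat.blt e.2 P.1) then
    ((((List.range P.1).filter fun x => !Nat.beq x v && Nat.blt (degOf P.1 P.2 x) 3).sublists.filter
      fun B => Nat.blt B.length 3).map fun B => (P.1 + 1, addVertex P.1 P.2 v B)).filter fun Q =>
        !known.any (hasSubgraph rooted Q)
  else [P]

lemma beq_eq_false_iff {i j : ℕ} : Nat.beq i j = false ↔ i ≠ j := by
  rw [Bool.eq_false_iff, ne_eq, Nat.beq_eq]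

lemma isInduced_append {V : Type u} {G : SimpleGraph V} {n : ℕ} {E E' : List (ℕ × ℕ)} {φ : ℕ → V}
    (hφ : IsInduced G n E φ) {l : List ℕ} (hl : ∀ x ∈ l, x < n)
    (h : IsInduced G l.length E' fun i => φ (l.getD i 0)) {x : ℕ} (hx : x < n)
    (hext : extendsBy E E' l x = true) :
    IsInduced G (l ++ [x]).length E' fun i => φ ((l ++ [x]).getD i 0) := by
  simp only [extendsBy, Bool.and_eq_true, List.all_eq_true, List.mem_reverse, List.mem_range,
    Bool.not_eq_true', beq_iff_eq, beq_eq_false_iff] at hext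
  obtain ⟨hloop, hext⟩ := hext
  have hlt : ∀ i < l.length, (l ++ [x]).getD i 0 = l.getD i 0 := fun i hi => by
    rw [List.getD_append _ _ _ _ hi]
  have hlast : (l ++ [x]).getD l.length 0 = x := by
    rw [List.getD_append_right _ _ _ _ le_rfl]; simp
  have hmem : ∀ i < l.length, l.getD i 0 < n := fun i hi => by
    rw [List.getD_eq_getElem _ _ hi]
    exact hl _ (List.getElem_mem hi)
  intro i hi j hj
  rw [List.length_append, List.length_singleton, Nat.lt_succ_iff_lt_or_eq] at hi hj
  rcases hi with hi | rfl <;> rcases hj with hj | rfl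
  · simp only [hlt i hi, hlt j hj]
    exact h i hi j hj
  · simp only [hlt i hi, hlast]
    have h1 := hφ _ (hmem i hi) x hx
    exact ⟨fun heq => absurd (h1.1 heq) (hext i hi).1, by rw [h1.2, (hext i hi).2]⟩
  · simp only [hlt j hj, hlast]
    have h1 := hφ x hx _ (hmem j hj)
    exact ⟨fun heq => absurd (h1.1 heq).symm (hext j hj).1, by
      rw [h1.2, adjOf_comm, (hext j hj).2, adjOf_comm]⟩
  · simp [hloop]

lemma exists_isInduced_of_findSubgraph {V : Type u} {G : SimpleGraph V} {n : ℕ}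
    {E E' : List (ℕ × ℕ)} {φ : ℕ → V} (hφ : IsInduced G n E φ) {k : ℕ} {l : List ℕ}
    (hl : ∀ x ∈ l, x < n) (h : IsInduced G l.length E' fun i => φ (l.getD i 0))
    (hfind : findSubgraph n E E' k l = true) : ∃ ψ, IsInduced G (l.length + k) E' ψ := by
  induction k generalizing l with
  | zero => exact ⟨_, h⟩
  | succ k ih =>
    simp only [findSubgraph, List.any_eq_true, List.mem_range, Bool.and_eq_true] at hfind
    obtain ⟨x, hx, hext, hfind⟩ := hfind
    obtain ⟨ψ, hψ⟩ := ih (l := l ++ [x])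
      (fun y hy => by
        rcases List.mem_append.1 hy with hy | hy
        · exact hl y hy
        · rwa [List.mem_singleton.1 hy])
      (isInduced_append hφ hl h hx hext) hfind
    refine ⟨ψ, ?_⟩
    rwa [List.length_append, List.length_singleton, add_assoc, add_comm 1] at hψ

lemma Free.of_hasSubgraph {V : Type u} {G : SimpleGraph V} {rooted : Bool}
    {Q R : ℕ × List (ℕ × ℕ)} (hR : Free G R) (h : hasSubgraph rooted Q R = true) : Free G Q := by
  intro φ hφ
  have hnil : IsInduced G ([] : List ℕ).length R.2 fun i => φ (([] : List ℕ).getD i 0) :=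
    fun i hi => absurd hi (Nat.not_lt_zero i)
  cases rooted
  · obtain ⟨ψ, hψ⟩ := exists_isInduced_of_findSubgraph hφ (by simp) hnil h
    exact hR ψ (by simpa using hψ)
  · simp only [hasSubgraph, cond_true, Bool.and_eq_true, Nat.blt_eq] at h
    obtain ⟨⟨⟨h1, h2⟩, h3⟩, h4⟩ := h
    obtain ⟨ψ, hψ⟩ := exists_isInduced_of_findSubgraph hφ (l := [Q.1 - 1])
      (by simpa using Nat.sub_lt h1 one_pos)
      (isInduced_append hφ (by simp) hnil (Nat.sub_lt h1 one_pos) h3) h4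
    refine hR ψ ?_
    rwa [List.length_singleton, Nat.add_sub_cancel' h2] at hψ

section Cubic

variable {V : Type u} [Fintype V] [DecidableEq V] {G : SimpleGraph V} [DecidableRel G.Adj]

lemma degOf_eq_card {n : ℕ} {E : List (ℕ × ℕ)} {φ : ℕ → V} (hφ : IsInduced G n E φ) {x : ℕ}
    (hx : x < n) : degOf n E x = #{w ∈ G.neighborFinset (φ x) | w ∈ (range n).image φ} := by
  have h1 : #(image φ {j ∈ range n | adjOf E x j = true}) = degOf n E x := by
    rw [degOf, ← card_filter_range_eq_countP]
    refine card_image_of_injOn fun s hs t ht hst => ?_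
    exact (hφ s (mem_range.1 (mem_filter.1 hs).1) t (mem_range.1 (mem_filter.1 ht).1)).1 hst
  rw [← h1]
  congr 1
  ext w
  simp only [mem_image, mem_filter, mem_range, SimpleGraph.mem_neighborFinset]
  constructor
  · rintro ⟨j, ⟨hj, hadj⟩, rfl⟩
    exact ⟨(hφ x hx j hj).2.2 hadj, j, hj, rfl⟩
  · rintro ⟨hadj, j, hj, rfl⟩
    exact ⟨j, ⟨hj, (hφ x hx j hj).2.1 hadj⟩, rfl⟩

/-- An induced subgraph of a cubic graph, one of whose vertices `v` has degree less than `3`, can be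
extended by a new neighbor of `v`. -/
lemma Free.of_children (hdeg : ∀ v, G.degree v = 3) {known : List (ℕ × List (ℕ × ℕ))}
    (hknown : ∀ R ∈ known, Free G R) (rooted : Bool) {P : ℕ × List (ℕ × ℕ)} (v : ℕ)
    (h : ∀ Q ∈ children known rooted P v, Free G Q) : Free G P := by
  obtain ⟨n, E⟩ := P
  unfold children at h
  cases hcond : (Nat.blt v n && Nat.blt (degOf n E v) 3 &&
    E.all (fun e => Nat.blt e.1 n && Nat.blt e.2 n))
  · rw [hcond, cond_false] at h
    exact h _ (by simp)
  rw [hcond, cond_true] at h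
  simp only [Bool.and_eq_true, Nat.blt_eq, List.all_eq_true] at hcond
  obtain ⟨⟨hv, hdv⟩, hE⟩ := hcond
  intro φ hφ
  simp only at hφ
  obtain ⟨w, hw, hwn⟩ : ∃ w, G.Adj (φ v) w ∧ w ∉ (range n).image φ := by
    by_contra! hcon
    have h1 := degOf_eq_card hφ hv
    rw [filter_true_of_mem fun w hw => hcon w (by simpa using hw),
      SimpleGraph.card_neighborFinset_eq_degree, hdeg] at h1
    omega
  have hopen : ∀ x < n, G.Adj (φ x) w → degOf n E x < 3 := fun x hx hadj => by
    rw [degOf_eq_card hφ hx, ← hdeg (φ x), ← SimpleGraph.card_neighborFinset_eq_degree]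
    refine card_lt_card ⟨filter_subset _ _, fun hsub => ?_⟩
    exact hwn (mem_filter.1 (hsub (by simpa using hadj))).2
  classical
  set B : List ℕ := ((List.range n).filter fun x =>
    !Nat.beq x v && Nat.blt (degOf n E x) 3).filter fun x => decide (G.Adj (φ x) w) with hB
  have hBmem : ∀ x, x ∈ B ↔ x < n ∧ x ≠ v ∧ G.Adj (φ x) w := fun x => by
    simp only [hB, List.mem_filter, List.mem_range, Bool.and_eq_true, Bool.not_eq_true',
      beq_eq_false_iff, Nat.blt_eq, decide_eq_true_eq]
    exact ⟨fun h => ⟨h.1.1, h.1.2.1, h.2⟩, fun h => ⟨⟨h.1, h.2.1, hopen x h.1 h.2.2⟩, h.2.2⟩⟩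
  have hinj : ∀ x < n, ∀ y < n, φ x = φ y → x = y := fun x hx y hy => (hφ x hx y hy).1
  have hBcard : B.length < 3 := by
    have hnodup : B.Nodup := (List.nodup_range.filter _).filter _
    have h1 : #(B.toFinset.image φ) = B.length := by
      rw [card_image_of_injOn, List.toFinset_card_of_nodup hnodup]
      intro x hx y hy hxy
      exact hinj x ((hBmem x).1 (by simpa using hx)).1 y ((hBmem y).1 (by simpa using hy)).1 hxy
    rw [← h1, ← hdeg w, ← SimpleGraph.card_neighborFinset_eq_degree]
    refine card_lt_card ⟨fun z hz => ?_, fun hsub => ?_⟩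
    · obtain ⟨x, hx, rfl⟩ := mem_image.1 hz
      simpa using ((hBmem x).1 (by simpa using hx)).2.2.symm
    · obtain ⟨x, hx, hxv⟩ := mem_image.1 (hsub (show φ v ∈ _ by simpa using hw.symm))
      have hx := (hBmem x).1 (by simpa using hx)
      exact hx.2.1 (hinj x hx.1 v hv hxv)
  have hφ' : IsInduced G (n + 1) (addVertex n E v B) (Function.update φ n w) := by
    have hne : ∀ x < n, Function.update φ n w x = φ x := fun x hx =>
      Function.update_of_ne hx.ne _ _
    have hold : ∀ i < n, ∀ j < n, adjOf (addVertex n E v B) i j = adjOf E i j := by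
      intro i hi j hj
      rw [Bool.eq_iff_iff, adjOf_iff, adjOf_iff]
      simp [addVertex, hi.ne, hi.ne', hj.ne, hj.ne']
    have hEn : ∀ i, (i, n) ∉ E ∧ (n, i) ∉ E := fun i =>
      ⟨fun hm => absurd (hE _ hm).2 (lt_irrefl n), fun hm => absurd (hE _ hm).1 (lt_irrefl n)⟩
    have hnew : ∀ i < n, (G.Adj (φ i) w ↔ adjOf (addVertex n E v B) i n = true) := by
      intro i hi
      rw [adjOf_iff]
      simp only [addVertex, List.mem_append, hEn, List.mem_cons, Prod.mk.injEq, List.mem_map,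
        and_true, exists_eq_right, false_or, hi.ne, and_false, hi.ne']
      constructor
      · intro hadj
        by_cases hiv : i = v
        · exact Or.inl (Or.inl hiv)
        · exact Or.inl (Or.inr ((hBmem i).2 ⟨hi, hiv, hadj⟩))
      · rintro ((rfl | hm) | hm)
        · exact hw
        · exact ((hBmem i).1 hm).2.2
        · exact absurd hm (by simp)
    intro i hi j hj
    rw [Nat.lt_succ_iff_lt_or_eq] at hi hj
    rcases hi with hi | rfl <;> rcases hj with hj | rfl
    · rw [hne i hi, hne j hj, hold i hi j hj]
      exact hφ i hi j hj
    · rw [hne i hi, Function.update_self]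
      exact ⟨fun heq => absurd (mem_image.2 ⟨i, mem_range.2 hi, heq⟩) hwn, hnew i hi⟩
    · rw [hne j hj, Function.update_self, adjOf_comm, G.adj_comm]
      exact ⟨fun heq => absurd (mem_image.2 ⟨j, mem_range.2 hj, heq.symm⟩) hwn, hnew j hj⟩
    · have : adjOf (addVertex j E v B) j j = false := by
        rw [Bool.eq_false_iff, ne_eq, adjOf_iff, or_self]
        simp only [addVertex, List.mem_append, List.mem_cons, Prod.mk.injEq, List.mem_map]
        rintro (h | ⟨h, -⟩ | ⟨x, hx, rfl, -⟩)
        · exact (hEn j).1 h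
        · omega
        · exact absurd ((hBmem x).1 hx).1 (lt_irrefl x)
      simp [this]
  by_cases hk : known.any (hasSubgraph rooted (n + 1, addVertex n E v B)) = true
  · obtain ⟨R, hR, hR'⟩ := List.any_eq_true.1 hk
    exact (hknown R hR).of_hasSubgraph hR' _ hφ'
  · refine h (n + 1, addVertex n E v B) ?_ _ hφ'
    rw [List.mem_filter]
    refine ⟨List.mem_map.2 ⟨B, List.mem_filter.2 ⟨?_, by simpa using hBcard⟩, rfl⟩,
      by simpa using hk⟩
    rw [List.mem_sublists]
    exact List.filter_sublist

/-- A certificate that `P` is reducible as an induced subgraph of a cubic graph. The vertices of `S`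
have degree `3` in `P` already, so they have no neighbors outside. -/
def leafCheck (P : ℕ × List (ℕ × ℕ)) (S : List ℕ) (U : List (ℕ × ℕ)) (a : List ℕ) : Bool :=
  (S.all fun s => Nat.blt s P.1 && Nat.beq (degOf P.1 P.2 s) 3) && configCheck P.1 P.2 S U a

lemma Free.of_leafCheck (hG : G.Connected) (hdeg : ∀ v, G.degree v = 3) (hbad : ¬ IntChoosable G)
    {P : ℕ × List (ℕ × ℕ)} {S : List ℕ} {U : List (ℕ × ℕ)} {a : List ℕ}
    (h : leafCheck P S U a = true) : Free G P := by
  intro φ hφ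
  simp only [leafCheck, Bool.and_eq_true, List.all_eq_true, Nat.blt_eq, Nat.beq_eq] at h
  refine hbad (intChoosable_of_configCheck hG (fun v => (hdeg v).le) hφ (fun s hs w hw => ?_) h.2)
  have h1 := h.1 s hs
  have h2 := h1.2
  rw [degOf_eq_card hφ h1.1, ← hdeg (φ s), ← SimpleGraph.card_neighborFinset_eq_degree,
    card_filter_eq_iff] at h2
  obtain ⟨j, hj, rfl⟩ := mem_image.1 (h2 w (by simpa using hw))
  exact ⟨j, mem_range.1 hj, rfl⟩

/-- A step in a proof that a graph is no induced subgraph. -/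
inductive Step
  /-- Add a new neighbor of the vertex `v`, in all possible ways. -/
  | branch (v : ℕ)
  /-- The graph is reducible with root set `S`, where the exponents `a` belong to the edges that
  meet `S`, in the order of the edge list. -/
  | leaf (S a : List ℕ)

/-- Checks a proof that no graph of the list is an induced subgraph, if those of the list `known`
are not. Each step deals with the first graph of the list. -/
def runSteps (known : List (ℕ × List (ℕ × ℕ))) : List Step → List (ℕ × List (ℕ × ℕ)) → Bool
  | _, [] => true
  | [], _ :: _ => false
  | .branch v :: t, P :: Ps => runSteps known t (children known false P v ++ Ps)
  | .leaf S a :: t, P :: Ps =>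
    leafCheck P S (P.2.filter fun e => memOf S e.1 || memOf S e.2) a && runSteps known t Ps

lemma Free.of_runSteps (hG : G.Connected) (hdeg : ∀ v, G.degree v = 3) (hbad : ¬ IntChoosable G)
    {known : List (ℕ × List (ℕ × ℕ))} (hknown : ∀ R ∈ known, Free G R) {t : List Step}
    {Ps : List (ℕ × List (ℕ × ℕ))} (h : runSteps known t Ps = true) : ∀ P ∈ Ps, Free G P := by
  induction t generalizing Ps with
  | nil =>
    cases Ps with
    | nil => simp
    | cons P Ps => simp [runSteps] at h
  | cons s t ih =>
    cases Ps with
    | nil => simp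
    | cons P Ps =>
      rw [List.forall_mem_cons]
      cases s with
      | branch v =>
        have := ih (by simpa only [runSteps] using h)
        exact ⟨Free.of_children hdeg hknown false v fun Q hQ => this Q (List.mem_append_left _ hQ),
          fun Q hQ => this Q (List.mem_append_right _ hQ)⟩
      | leaf S a =>
        rw [runSteps, Bool.and_eq_true] at h
        exact ⟨Free.of_leafCheck hG hdeg hbad h.1, ih h.2⟩

/-- The graphs that arise from `P` by adding new neighbors of the vertices of a list in turn. -/
def expand (known : List (ℕ × List (ℕ × ℕ))) : List ℕ → ℕ × List (ℕ × ℕ) → List (ℕ × List (ℕ × ℕ))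
  | [], P => [P]
  | v :: vs, P => (children known true P v).flatMap (expand known vs)

lemma Free.of_expand (hdeg : ∀ v, G.degree v = 3) {known : List (ℕ × List (ℕ × ℕ))}
    (hknown : ∀ R ∈ known, Free G R) {vs : List ℕ} {P : ℕ × List (ℕ × ℕ)}
    (h : ∀ Q ∈ expand known vs P, Free G Q) : Free G P := by
  induction vs generalizing P with
  | nil => exact h P (by simp [expand])
  | cons v vs ih =>
    exact Free.of_children hdeg hknown true v fun Q hQ => ih fun R hR =>
      h R (List.mem_flatMap.2 ⟨Q, hQ, hR⟩)

end Cubic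

/-! ### Short cycles -/

/-- The triangle. -/
def triangle : ℕ × List (ℕ × ℕ) := (3, [(0, 1), (1, 2), (0, 2)])

/-- The complete bipartite graph with parts `{0, 2}` and `{1, 3, 4}`. -/
def bipartiteTwoThree : ℕ × List (ℕ × ℕ) :=
  (5, [(0, 1), (1, 2), (2, 3), (0, 3), (0, 4), (2, 4)])

/-- Two `4`-cycles sharing an edge. -/
def domino : ℕ × List (ℕ × ℕ) :=
  (6, [(0, 1), (1, 2), (2, 3), (0, 3), (2, 4), (4, 5), (3, 5)])

/-- A `4`-cycle and a path of length `3` between two opposite vertices of it. -/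
def theta : ℕ × List (ℕ × ℕ) :=
  (6, [(0, 1), (1, 2), (2, 3), (0, 3), (1, 4), (3, 5), (4, 5)])

/-- The cycle of length `4`. -/
def cycleFour : ℕ × List (ℕ × ℕ) := (4, [(0, 1), (1, 2), (2, 3), (0, 3)])

/-- The cycle of length `5`. -/
def cycleFive : ℕ × List (ℕ × ℕ) := (5, [(0, 1), (1, 2), (2, 3), (3, 4), (0, 4)])

/-- The cycle of length `6`. -/
def cycleSix : ℕ × List (ℕ × ℕ) := (6, [(0, 1), (1, 2), (2, 3), (3, 4), (4, 5), (0, 5)])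

section

variable {V : Type u} [Fintype V] [DecidableEq V] {G : SimpleGraph V} [DecidableRel G.Adj]

lemma free_triangle (hG : G.Connected) (hdeg : ∀ v, G.degree v = 3) (hbad : ¬ IntChoosable G) :
    Free G triangle :=
  Free.of_runSteps hG hdeg hbad (known := []) (by simp)
    (t := [.branch 0, .branch 1, .leaf [0, 1] [0, 3, 4, 1, 2], .leaf [1] [0, 1, 2],
      .leaf [0, 1] [0, 1, 4, 2, 3], .leaf [1] [0, 1, 2], .leaf [0] [0, 1, 2], .leaf [0] [0, 1, 2],
      .leaf [0] [0, 1, 2]]) (Ps := [triangle]) (by decide +kernel) _ (by simp)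

lemma free_bipartiteTwoThree (hG : G.Connected) (hdeg : ∀ v, G.degree v = 3)
    (hbad : ¬ IntChoosable G) : Free G bipartiteTwoThree :=
  Free.of_runSteps hG hdeg hbad (known := [triangle]) (by simpa using free_triangle hG hdeg hbad)
    (t := [.branch 4, .branch 3, .leaf [0, 2, 3, 4] [5, 6, 4, 3, 1, 2, 3, 3],
      .leaf [0, 1, 4] [0, 1, 6, 3, 5, 2, 3], .branch 5, .leaf [0, 2, 5] [0, 1, 2, 6, 7, 6, 4, 3, 1],
      .leaf [0, 2, 5] [0, 1, 2, 6, 7, 6, 4, 3, 3], .leaf [0, 1, 2] [0, 1, 2, 6, 3, 4, 5],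
      .leaf [0, 1, 2] [0, 1, 2, 3, 4, 6, 5], .leaf [0, 2, 3] [0, 1, 2, 3, 4, 6, 5],
      .leaf [0, 1, 2] [0, 1, 2, 3, 4, 5, 6]]) (Ps := [bipartiteTwoThree]) (by decide +kernel) _
    (by simp)

lemma free_domino (hG : G.Connected) (hdeg : ∀ v, G.degree v = 3)
    (hbad : ¬ IntChoosable G) : Free G domino :=
  Free.of_runSteps hG hdeg hbad (known := [triangle]) (by simpa using free_triangle hG hdeg hbad)
    (t := [.branch 0, .branch 4, .leaf [0, 3, 4] [3, 6, 3, 4, 3, 3, 0, 0],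
      .leaf [2, 3, 4] [5, 0, 3, 4, 2, 3, 3], .leaf [0, 3, 4] [3, 6, 3, 4, 3, 3, 0, 1],
      .leaf [1, 2, 7] [5, 0, 3, 4, 2, 3, 3], .leaf [0, 3, 4] [4, 6, 4, 5, 4, 3, 0, 1],
      .leaf [2, 3, 5] [3, 4, 5, 0, 2, 3, 3]]) (Ps := [domino]) (by decide +kernel) _ (by simp)

lemma free_theta (hG : G.Connected) (hdeg : ∀ v, G.degree v = 3)
    (hbad : ¬ IntChoosable G) : Free G theta :=
  Free.of_runSteps hG hdeg hbad (known := [triangle, bipartiteTwoThree, domino])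
    (by
      simpa using ⟨free_triangle hG hdeg hbad, free_bipartiteTwoThree hG hdeg hbad,
        free_domino hG hdeg hbad⟩)
    (t := [.branch 0, .branch 4, .leaf [0, 1, 3, 4] [5, 6, 5, 0, 4, 3, 4, 3, 2],
      .leaf [0, 3, 4] [5, 4, 3, 3, 2, 3, 3, 2]]) (Ps := [theta]) (by decide +kernel) _ (by simp)

lemma free_cycleFour (hG : G.Connected) (hdeg : ∀ v, G.degree v = 3)
    (hbad : ¬ IntChoosable G) : Free G cycleFour :=
  Free.of_runSteps hG hdeg hbad (known := [triangle, bipartiteTwoThree, domino, theta])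
    (by
      simpa using ⟨free_triangle hG hdeg hbad, free_bipartiteTwoThree hG hdeg hbad,
        free_domino hG hdeg hbad, free_theta hG hdeg hbad⟩)
    (t := [.branch 0, .branch 1, .branch 2, .branch 3, .leaf [0, 1, 2, 3] [3, 4, 5, 2, 3, 3, 3, 3]])
    (Ps := [cycleFour]) (by decide +kernel) _ (by simp)

/-- Raises the entry `p` of `a` by one for each triple `(i, j, p)` such that `i` and `j` are
adjacent in the graph with edge list `E`. -/
def raise (E : List (ℕ × ℕ)) (a : List ℕ) (t : List (ℕ × ℕ × ℕ)) : List ℕ :=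
  t.foldl (fun a e => bif adjOf E e.1 e.2.1 then a.set e.2.2 (a.getD e.2.2 0 + 1) else a) a

lemma free_cycleFive (hG : G.Connected) (hdeg : ∀ v, G.degree v = 3)
    (hbad : ¬ IntChoosable G) : Free G cycleFive := by
  refine Free.of_expand hdeg (known := [triangle, cycleFour])
    (by simpa using ⟨free_triangle hG hdeg hbad, free_cycleFour hG hdeg hbad⟩)
    (vs := [0, 1, 2, 3, 4]) fun Q hQ => ?_
  -- An edge between two vertices off the cycle adds one conflict, which one exponent absorbs.
  refine Free.of_leafCheck hG hdeg hbad (S := [0, 1, 2, 3, 4])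
    (U := [(0, 1), (1, 2), (2, 3), (3, 4), (0, 4), (0, 5), (1, 6), (2, 7), (3, 8), (4, 9)])
    (a := raise Q.2 [5, 5, 5, 4, 5, 3, 2, 1, 2, 3]
      [(5, 7, 5), (6, 8, 6), (7, 9, 9), (5, 8, 5), (6, 9, 6)]) ?_
  revert Q
  rw [← List.all_eq_true]
  decide +kernel

lemma free_cycleSix (hG : G.Connected) (hdeg : ∀ v, G.degree v = 3)
    (hbad : ¬ IntChoosable G) : Free G cycleSix := by
  refine Free.of_expand hdeg (known := [triangle, cycleFour, cycleFive])
    (by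
      simpa using ⟨free_triangle hG hdeg hbad, free_cycleFour hG hdeg hbad,
        free_cycleFive hG hdeg hbad⟩)
    (vs := [0, 1, 2, 3, 4, 5]) fun Q hQ => ?_
  refine Free.of_leafCheck hG hdeg hbad (S := [0, 1, 2, 3, 4, 5])
    (U := [(0, 6), (0, 1), (1, 7), (1, 2), (2, 8), (2, 3), (3, 9), (3, 4), (4, 10), (4, 5), (5, 11),
      (0, 5)])
    (a := raise Q.2 [0, 5, 3, 5, 3, 4, 3, 5, 1, 5, 3, 5] [(6, 9, 6), (7, 10, 2), (8, 11, 4)]) ?_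
  revert Q
  rw [← List.all_eq_true]
  decide +kernel

end

/-! ### A shortest cycle -/

section

variable {V : Type u} [Fintype V] [DecidableEq V] {G : SimpleGraph V} [DecidableRel G.Adj]

/-- A vertex of degree at most `2` makes the graph reducible. -/
lemma intChoosable_of_degree_lt (hG : G.Connected) (hdeg : ∀ v, G.degree v ≤ 3) {v : V}
    (hv : G.degree v < 3) : IntChoosable G := by
  rw [← SimpleGraph.card_neighborFinset_eq_degree] at hv
  have hn : ∀ w, w ∈ G.neighborFinset v ↔ G.Adj v w := fun w => G.mem_neighborFinset v w
  generalize G.neighborFinset v = N at hv hn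
  obtain h | h | h : #N = 0 ∨ #N = 1 ∨ #N = 2 := by omega
  · obtain rfl := card_eq_zero.1 h
    refine intChoosable_of_configCheck (n := 1) (E := []) (φ := fun _ => v) (S := [0]) (U := [])
      (a := []) hG hdeg (fun i hi j hj => ?_) (fun s _ w hw => ?_) (by decide +kernel)
    · obtain rfl : i = 0 := by omega
      obtain rfl : j = 0 := by omega
      simp [adjOf]
    · simpa using (hn w).2 hw
  · obtain ⟨a, rfl⟩ := card_eq_one.1 h
    have ha : G.Adj v a := (hn a).1 (by simp)
    refine intChoosable_of_configCheck (n := 2) (E := [(0, 1)])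
      (φ := fun i => if i = 0 then v else a) (S := [0]) (U := [(0, 1)])
      (a := [0]) hG hdeg (fun i hi j hj => ?_) (fun s hs w hw => ?_) (by decide +kernel)
    · interval_cases i <;> interval_cases j <;> simp [adjOf, ha, ha.symm, ha.ne, ha.ne']
    · obtain rfl : s = 0 := by simpa using hs
      have := (hn w).2 hw
      exact ⟨1, by norm_num, by simpa using this⟩
  · obtain ⟨a, b, hab, rfl⟩ := card_eq_two.1 h
    have ha : G.Adj v a := (hn a).1 (by simp)
    have hb : G.Adj v b := (hn b).1 (by simp)
    have hclosed : ∀ s ∈ [0], ∀ w, G.Adj (if s = 0 then v else if s = 1 then a else b) w →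
        ∃ j < 3, w = if j = 0 then v else if j = 1 then a else b := by
      intro s hs w hw
      obtain rfl : s = 0 := by simpa using hs
      have := (hn w).2 hw
      rw [mem_insert, mem_singleton] at this
      rcases this with rfl | rfl
      · exact ⟨1, by norm_num, by simp⟩
      · exact ⟨2, by norm_num, by simp⟩
    by_cases hadj : G.Adj a b
    · refine intChoosable_of_configCheck (n := 3) (E := [(0, 1), (0, 2), (1, 2)])
        (φ := fun i => if i = 0 then v else if i = 1 then a else b) (S := [0])
        (U := [(0, 1), (0, 2)]) (a := [0, 1]) hG hdeg (fun i hi j hj => ?_) hclosed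
        (by decide +kernel)
      interval_cases i <;> interval_cases j <;>
        simp [adjOf, ha, ha.symm, ha.ne, ha.ne', hb, hb.symm, hb.ne, hb.ne', hadj, hadj.symm, hab,
          hab.symm]
    · have hadj' : ¬ G.Adj b a := fun h => hadj h.symm
      refine intChoosable_of_configCheck (n := 3) (E := [(0, 1), (0, 2)])
        (φ := fun i => if i = 0 then v else if i = 1 then a else b) (S := [0])
        (U := [(0, 1), (0, 2)]) (a := [0, 1]) hG hdeg (fun i hi j hj => ?_) hclosed
        (by decide +kernel)
      interval_cases i <;> interval_cases j <;>
        simp [adjOf, ha, ha.symm, ha.ne, ha.ne', hb, hb.symm, hb.ne, hb.ne', hadj, hadj', hab,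
          hab.symm]

/-- The vertices `v 0, …, v (g - 1)` form a cycle of `G`, in this order. The values of `v` from `g`
on do not matter. -/
def IsCyclic (G : SimpleGraph V) (g : ℕ) (v : ℕ → V) : Prop :=
  3 ≤ g ∧ (∀ i < g, ∀ j < g, v i = v j → i = j) ∧ (∀ i, i + 1 < g → G.Adj (v i) (v (i + 1))) ∧
    G.Adj (v (g - 1)) (v 0)

omit [DecidableEq V] in
lemma exists_isCyclic (hG : G.Connected) (hdeg : ∀ v, G.degree v = 3) :
    ∃ g v, IsCyclic G g v := by
  by_cases hac : G.IsAcyclic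
  · have h1 := SimpleGraph.IsTree.card_edgeFinset ⟨hG, hac⟩
    have h2 := G.sum_degrees_eq_twice_card_edges
    simp only [hdeg, sum_const, card_univ, smul_eq_mul] at h2
    omega
  · simp only [SimpleGraph.IsAcyclic, not_forall, not_not] at hac
    obtain ⟨a, c, hc⟩ := hac
    have hlen := hc.three_le_length
    refine ⟨c.length, c.getVert, hlen, fun i hi j hj hij => ?_, fun i hi => ?_, ?_⟩
    · exact hc.getVert_injOn' (by simp; omega) (by simp; omega) hij
    · exact c.adj_getVert_succ (by omega)
    · have := c.adj_getVert_succ (i := c.length - 1) (by omega)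
      rw [Nat.sub_add_cancel (by omega), c.getVert_length] at this
      rwa [c.getVert_zero]

end

/-- A shortest cycle, with its vertices repeated periodically. -/
structure IsShortestCycle {V : Type u} (G : SimpleGraph V) (g : ℕ) (v : ℕ → V) : Prop where
  three_le : 3 ≤ g
  periodic : ∀ i, v (i + g) = v i
  inj : ∀ i j, v i = v j → i < j → g ≤ j - i
  adj : ∀ i, G.Adj (v i) (v (i + 1))
  le_of_isCyclic : ∀ k w, IsCyclic G k w → g ≤ k

namespace IsShortestCycle

variable {V : Type u} {G : SimpleGraph V} {g : ℕ} {v : ℕ → V}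

lemma exists_of_isCyclic (h : ∃ g v, IsCyclic G g v) : ∃ g v, IsShortestCycle G g v := by
  classical
  obtain ⟨v, hg, hinj, hadj, hlast⟩ := Nat.find_spec h
  set g := Nat.find h with hgdef
  have hg0 : 0 < g := by omega
  refine ⟨g, fun i => v (i % g), hg, fun i => by simp, fun i j hij hlt => ?_, fun i => ?_,
    fun k w hw => Nat.find_min' h ⟨w, hw⟩⟩
  · have := hinj _ (Nat.mod_lt _ hg0) _ (Nat.mod_lt _ hg0) hij
    exact Nat.le_of_dvd (by omega) ((Nat.modEq_iff_dvd' hlt.le).1 this)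
  · have hi := Nat.mod_lt i hg0
    rw [Nat.add_mod, Nat.mod_eq_of_lt (show 1 < g by omega)]
    by_cases h1 : i % g + 1 < g
    · rw [Nat.mod_eq_of_lt h1]
      exact hadj _ h1
    · have h2 : i % g = g - 1 := by omega
      rw [h2, Nat.sub_add_cancel hg0, Nat.mod_self]
      exact hlast

variable (h : IsShortestCycle G g v)
include h

/-- An edge between two vertices at distance `d` along a shortest cycle closes a cycle of length
`d + 1`. In the same way `le_of_common` and `le_of_path` deal with paths of length `2` and `3` that
leave the cycle. -/
lemma le_of_chord {i d : ℕ} (hd : 2 ≤ d) (hdg : d < g) (hadj : G.Adj (v (i + d)) (v i)) :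
    g ≤ d + 1 := by
  refine h.le_of_isCyclic (d + 1) (fun k => v (i + k)) ⟨by omega, fun a ha b hb hab => ?_,
    fun k _ => h.adj _, by simpa using hadj⟩
  rcases lt_trichotomy a b with hlt | heq | hlt
  · have := h.inj _ _ hab (by omega); omega
  · exact heq
  · have := h.inj _ _ hab.symm (by omega); omega

lemma le_of_common {i d : ℕ} (hd : 1 ≤ d) (hdg : d < g) {a : V} (ha : ∀ k, v k ≠ a)
    (h1 : G.Adj (v (i + d)) a) (h2 : G.Adj a (v i)) : g ≤ d + 2 := by
  have hlt : ∀ k < d + 1, (if k < d + 1 then v (i + k) else a) = v (i + k) := fun k hk =>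
    if_pos hk
  refine h.le_of_isCyclic (d + 2) (fun k => if k < d + 1 then v (i + k) else a)
    ⟨by omega, fun p hp q hq hpq => ?_, fun k hk => ?_, ?_⟩
  · simp only at hpq
    split_ifs at hpq with hp' hq' hq'
    · rcases lt_trichotomy p q with hlt | heq | hlt
      · have := h.inj _ _ hpq (by omega); omega
      · exact heq
      · have := h.inj _ _ hpq.symm (by omega); omega
    · exact absurd hpq (ha _)
    · exact absurd hpq.symm (ha _)
    · omega
  · simp only
    rw [if_pos (by omega)]
    split_ifs with hk'
    · exact h.adj _
    · obtain rfl : k = d := by omega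
      exact h1
  · simpa using h2

lemma le_of_path {i d : ℕ} (hd : 1 ≤ d) (hdg : d < g) {a b : V} (ha : ∀ k, v k ≠ a)
    (hb : ∀ k, v k ≠ b) (h1 : G.Adj (v (i + d)) a) (hab : G.Adj a b) (h2 : G.Adj b (v i)) :
    g ≤ d + 3 := by
  refine h.le_of_isCyclic (d + 3) (fun k => if k < d + 1 then v (i + k) else if k < d + 2 then a
    else b) ⟨by omega, fun p hp q hq hpq => ?_, fun k hk => ?_, ?_⟩
  · simp only at hpq
    split_ifs at hpq with hp' hq' hq' hp'' hq' hq' hq' hq'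
    · rcases lt_trichotomy p q with hlt | heq | hlt
      · have := h.inj _ _ hpq (by omega); omega
      · exact heq
      · have := h.inj _ _ hpq.symm (by omega); omega
    all_goals first
      | omega
      | exact absurd hpq (ha _)
      | exact absurd hpq (hb _)
      | exact absurd hpq.symm (ha _)
      | exact absurd hpq.symm (hb _)
      | exact absurd hpq hab.ne
      | exact absurd hpq.symm hab.ne
  · simp only
    split_ifs with h3 h4 h5 h6 h7
    all_goals first
      | omega
      | exact h.adj _
      | exact hab
      | (obtain rfl : k = d := by omega
         exact h1)
  · simpa using h2

/-- A shortest cycle has no chords. -/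
lemma adj_iff {i j : ℕ} (hi : i < j) (hj : j < i + g) :
    G.Adj (v i) (v j) ↔ j = i + 1 ∨ i + g = j + 1 := by
  obtain ⟨d, rfl⟩ := Nat.exists_eq_add_of_le hi.le
  have := h.three_le
  constructor
  · intro hadj
    by_cases hd : 2 ≤ d
    · have := h.le_of_chord hd (by omega) hadj.symm
      omega
    · omega
  · rintro (h1 | h1)
    · rw [h1]; exact h.adj i
    · have := h.adj (i + d)
      rw [← h1, h.periodic] at this
      exact this.symm

end IsShortestCycle

namespace IsShortestCycle

variable {V : Type u} {G : SimpleGraph V} {g : ℕ} {v : ℕ → V}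

lemma isInduced (h : IsShortestCycle G g v) {E : List (ℕ × ℕ)}
    (hE : ∀ i < g, ∀ j < g, adjOf E i j =
      decide (j = i + 1 ∨ i + g = j + 1 ∨ i = j + 1 ∨ j + g = i + 1)) : IsInduced G g E v := by
  have h3 := h.three_le
  intro i hi j hj
  refine ⟨fun hij => ?_, ?_⟩
  · rcases lt_trichotomy i j with hlt | heq | hlt
    · have := h.inj _ _ hij hlt; omega
    · exact heq
    · have := h.inj _ _ hij.symm hlt; omega
  · rw [hE i hi j hj, decide_eq_true_eq]
    rcases lt_trichotomy i j with hlt | rfl | hlt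
    · rw [h.adj_iff hlt (by omega)]; omega
    · simp; omega
    · rw [G.adj_comm, h.adj_iff hlt (by omega)]; omega

lemma periodic_mul (h : IsShortestCycle G g v) (i q : ℕ) : v (i + q * g) = v i := by
  induction q with
  | zero => simp
  | succ q ih => rw [Nat.succ_mul, ← add_assoc, h.periodic, ih]

lemma exists_shift (h : IsShortestCycle G g v) (i k : ℕ) : ∃ d < g, v k = v (i + d) := by
  have h3 := h.three_le
  obtain ⟨m, hm⟩ : ∃ m, k + i * g = i + m := ⟨k + i * g - i, by
    have : i ≤ i * g := Nat.le_mul_of_pos_right _ (by omega)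
    omega⟩
  refine ⟨m % g, Nat.mod_lt _ (by omega), ?_⟩
  rw [← h.periodic_mul k i, hm, ← h.periodic_mul (i + m % g) (m / g), add_assoc, mul_comm,
    Nat.mod_add_div]

end IsShortestCycle

/-- In a cubic graph, `u i` is the third neighbor of the vertex `v i` of a shortest cycle. It lies
off the cycle. -/
structure IsThirdNeighbor {V : Type u} (G : SimpleGraph V) (g : ℕ) (v u : ℕ → V) : Prop where
  adj : ∀ i, G.Adj (v i) (u i)
  periodic : ∀ i, u (i + g) = u i
  eq_of_adj : ∀ i w, G.Adj (v i) w → w = v (i + 1) ∨ w = v (i + g - 1) ∨ w = u i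
  ne : ∀ i k, v k ≠ u i

namespace IsShortestCycle

variable {V : Type u} {G : SimpleGraph V} {g : ℕ} {v u : ℕ → V}

lemma exists_isThirdNeighbor [Fintype V] [DecidableEq V] [DecidableRel G.Adj]
    (h : IsShortestCycle G g v) (hdeg : ∀ v, G.degree v = 3) :
    ∃ u, IsThirdNeighbor G g v u := by
  have h3 := h.three_le
  have hex : ∀ i, ∃ u, G.neighborFinset (v i) = {v (i + 1), v (i + g - 1), u} ∧
      u ≠ v (i + 1) ∧ u ≠ v (i + g - 1) := by
    intro i
    have h1 : v (i + 1) ∈ G.neighborFinset (v i) := by simpa using h.adj i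
    have h2 : v (i + g - 1) ∈ (G.neighborFinset (v i)).erase (v (i + 1)) := by
      rw [mem_erase, SimpleGraph.mem_neighborFinset, h.adj_iff (by omega) (by omega)]
      refine ⟨fun heq => ?_, Or.inr (by omega)⟩
      have := h.inj _ _ heq.symm (by omega)
      omega
    have h4 : #(((G.neighborFinset (v i)).erase (v (i + 1))).erase (v (i + g - 1))) = 1 := by
      rw [card_erase_of_mem h2, card_erase_of_mem h1, SimpleGraph.card_neighborFinset_eq_degree,
        hdeg]
    obtain ⟨u, hu⟩ := card_eq_one.1 h4
    refine ⟨u, ?_, ?_⟩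
    · rw [← insert_erase h1, ← insert_erase h2, hu]
    · have : u ∈ ((G.neighborFinset (v i)).erase (v (i + 1))).erase (v (i + g - 1)) := by
        rw [hu]; simp
      rw [mem_erase, mem_erase] at this
      exact ⟨this.2.1, this.1⟩
  choose t ht htv htv' using hex
  have hmod : ∀ i, v (i % g) = v i := fun i => by
    conv_rhs => rw [← Nat.mod_add_div i g, mul_comm, h.periodic_mul]
  have hsucc : ∀ i, v (i % g + 1) = v (i + 1) := fun i => by
    conv_rhs => rw [← Nat.mod_add_div i g, add_right_comm, mul_comm, h.periodic_mul]
  have hpred : ∀ i, v (i % g + g - 1) = v (i + g - 1) := fun i => by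
    conv_rhs => rw [← Nat.mod_add_div i g, mul_comm,
      show i % g + i / g * g + g - 1 = i % g + g - 1 + i / g * g by omega, h.periodic_mul]
  have hadj : ∀ i, G.Adj (v i) (t (i % g)) := fun i => by
    rw [← hmod i, ← SimpleGraph.mem_neighborFinset, ht]
    simp
  refine ⟨fun i => t (i % g), hadj, fun i => by simp, fun i w hw => ?_, fun i k hk => ?_⟩
  · rw [← hmod i, ← SimpleGraph.mem_neighborFinset, ht, hsucc, hpred] at hw
    simpa using hw
  · obtain ⟨d, hd, hkd⟩ := h.exists_shift i k
    rw [hk] at hkd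
    have := hadj i
    rw [hkd] at this
    have hd0 : d ≠ 0 := by
      rintro rfl
      exact G.irrefl this
    rcases (h.adj_iff (show i < i + d by omega) (by omega)).1 this with h5 | h5
    · refine htv (i % g) ?_
      rw [hkd, hsucc, h5]
    · refine htv' (i % g) ?_
      rw [hkd, hpred, h5, Nat.add_sub_cancel]

lemma index_of_near (h : IsShortestCycle G g v) {i j : ℕ} (hi : i ≤ g) (hj : j ≤ g)
    (hij : v i = v j ∨ G.Adj (v i) (v j)) :
    i = j ∨ i + g = j ∨ j + g = i ∨ j = i + 1 ∨ i = j + 1 ∨ i + g = j + 1 ∨ j + g = i + 1 := by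
  wlog hle : i ≤ j generalizing i j
  · have := this hj hi (hij.imp Eq.symm SimpleGraph.Adj.symm) (by omega)
    omega
  rcases hle.eq_or_lt with heq | hlt
  · exact Or.inl heq
  rcases hij with heq | hadj
  · have := h.inj _ _ heq hlt
    omega
  · by_cases hj' : j < i + g
    · have := (h.adj_iff hlt hj').1 hadj
      omega
    · omega

variable (h : IsShortestCycle G g v) (hu : IsThirdNeighbor G g v u) (hg : 7 ≤ g)
include h hu hg

lemma thirdNeighbor_far {i d : ℕ} (hd : 1 ≤ d) (hdg : d < g) :
    u i ≠ u (i + d) ∧ ¬ G.Adj (u i) (u (i + d)) := by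
  have hwrap : v (i + d + (g - d)) = v i := by
    rw [show i + d + (g - d) = i + g by omega, h.periodic]
  constructor
  · intro heq
    have h1 := h.le_of_common hd hdg (hu.ne i) (heq ▸ hu.adj (i + d)) (hu.adj i).symm
    have h2 := h.le_of_common (i := i + d) (d := g - d) (by omega) (by omega) (hu.ne i)
      (by rw [hwrap]; exact hu.adj i) (heq ▸ (hu.adj (i + d)).symm)
    omega
  · intro hadj
    have h1 := h.le_of_path hd hdg (hu.ne (i + d)) (hu.ne i) (hu.adj (i + d)) hadj.symm
      (hu.adj i).symm
    have h2 := h.le_of_path (i := i + d) (d := g - d) (by omega) (by omega) (hu.ne i)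
      (hu.ne (i + d)) (by rw [hwrap]; exact hu.adj i) hadj (hu.adj (i + d)).symm
    omega

lemma thirdNeighbor_eq {i j : ℕ} (hi : i < g) (hj : j < g)
    (hij : u i = u j ∨ G.Adj (u i) (u j)) : i = j := by
  rcases lt_trichotomy i j with hlt | heq | hlt
  · obtain ⟨d, rfl⟩ := Nat.exists_eq_add_of_le hlt.le
    have := h.thirdNeighbor_far hu hg (i := i) (d := d) (by omega) (by omega)
    tauto
  · exact heq
  · obtain ⟨d, rfl⟩ := Nat.exists_eq_add_of_le hlt.le
    have := h.thirdNeighbor_far hu hg (i := j) (d := d) (by omega) (by omega)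
    rw [G.adj_comm] at this
    tauto

lemma index_of_near_third {i j : ℕ} (hi : i ≤ g) (hj : j < g)
    (hij : v i = u j ∨ G.Adj (v i) (u j)) : i = j ∨ i = j + g := by
  have hadj := hij.resolve_left (hu.ne j i)
  rcases hu.eq_of_adj i _ hadj with h1 | h1 | h1
  · exact absurd h1.symm (hu.ne j _)
  · exact absurd h1.symm (hu.ne j _)
  · rcases hi.eq_or_lt with rfl | hi
    · have h2 := hu.periodic 0
      rw [zero_add] at h2
      rw [h2] at h1
      have := h.thirdNeighbor_eq hu hg hj (by omega) (Or.inl h1)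
      omega
    · exact Or.inl (h.thirdNeighbor_eq hu hg hj hi (Or.inl h1)).symm

end IsShortestCycle

/-- The edges that meet the cycle `v`: number `2 * i + 1` is the cycle edge from `v i` to
`v (i + 1)`, and number `2 * i` joins `v i` to its third neighbor. -/
def stripEdge {V : Type u} (v u : ℕ → V) (y : ℕ) : Sym2 V :=
  if y % 2 = 1 then s(v (y / 2), v (y / 2 + 1)) else s(v (y / 2), u (y / 2))

namespace IsShortestCycle

variable {V : Type u} {G : SimpleGraph V} {g : ℕ} {v u : ℕ → V}

lemma exists_stripEdge (h : IsShortestCycle G g v)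
    (hu : IsThirdNeighbor G g v u) {e : Sym2 V} (he : e ∈ G.edgeSet) {k : ℕ} (hk : k < g)
    (hke : v k ∈ e) :
    ∃ y < 2 * g, stripEdge v u y = e := by
  have h3 := h.three_le
  obtain ⟨w, rfl⟩ := Sym2.mem_iff_exists.1 hke
  have hodd : ∀ i, stripEdge v u (2 * i + 1) = s(v i, v (i + 1)) := fun i => by
    rw [stripEdge, if_pos (by omega), show (2 * i + 1) / 2 = i by omega]
  rcases hu.eq_of_adj k w he with rfl | rfl | rfl
  · exact ⟨2 * k + 1, by omega, hodd k⟩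
  · rcases Nat.eq_zero_or_pos k with rfl | hk0
    · refine ⟨2 * (g - 1) + 1, by omega, ?_⟩
      have := h.periodic 0
      rw [zero_add] at this
      rw [hodd, Nat.sub_add_cancel (by omega), this, zero_add, Sym2.eq_swap]
    · refine ⟨2 * (k - 1) + 1, by omega, ?_⟩
      have := h.periodic (k - 1)
      rw [hodd, Nat.sub_add_cancel hk0, show k + g - 1 = k - 1 + g by omega, this, Sym2.eq_swap]
  · refine ⟨2 * k, by omega, ?_⟩
    rw [stripEdge, if_neg (by omega), show 2 * k / 2 = k by omega]

lemma forall_notMem_iff [DecidableEq V] (h : IsShortestCycle G g v) (f : Sym2 V) :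
    (∀ s ∈ (range g).image v, s ∉ f) ↔ ∀ k, v k ∉ f := by
  constructor
  · intro hf k
    obtain ⟨d, hd, hkd⟩ := h.exists_shift 0 k
    rw [hkd, zero_add]
    exact hf _ (mem_image_of_mem _ (mem_range.2 hd))
  · intro hf s hs
    obtain ⟨k, -, rfl⟩ := mem_image.1 hs
    exact hf k

/-- Few edges off the cycle conflict with an edge that meets the cycle: up to four for an edge of
the cycle, and up to six otherwise. -/
lemma card_conf_stripEdge_le [Fintype V] [DecidableEq V] [DecidableRel G.Adj]
    (h : IsShortestCycle G g v) (hu : IsThirdNeighbor G g v u)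
    (hdeg : ∀ v, G.degree v = 3) (y : ℕ) :
    #{f ∈ G.edgeFinset | Conf G (stripEdge v u y) f ∧ ∀ s ∈ (range g).image v, s ∉ f} ≤
      if y % 2 = 1 then 4 else 6 := by
  set i := y / 2 with hi
  have hthird : ∀ i (f : Sym2 V) z, (∀ k, v k ∉ f) → z ∈ f → G.Adj (v i) z → z = u i := by
    intro i f z hf hz hadj
    rcases hu.eq_of_adj i z hadj with rfl | rfl | rfl
    · exact absurd hz (hf _)
    · exact absurd hz (hf _)
    · rfl
  unfold stripEdge
  split_ifs with hy
  · have hE : ∀ i, #((G.incidenceFinset (u i)).erase s(v i, u i)) = 2 := fun i => by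
      rw [card_erase_of_mem, SimpleGraph.card_incidenceFinset_eq_degree, hdeg]
      rw [SimpleGraph.mem_incidenceFinset, SimpleGraph.mk'_mem_incidenceSet_right_iff]
      exact hu.adj i
    refine (card_le_card (t := (G.incidenceFinset (u i)).erase s(v i, u i) ∪
      (G.incidenceFinset (u (i + 1))).erase s(v (i + 1), u (i + 1))) fun f hf => ?_).trans
      ((card_union_le _ _).trans (by rw [hE, hE]))
    rw [mem_filter, SimpleGraph.mem_edgeFinset, h.forall_notMem_iff] at hf
    obtain ⟨hfG, hconf, hfv⟩ := hf
    obtain ⟨z, hz, -, -, hz'⟩ := hconf.exists_neighbor (h.adj i) hfG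
    have hmem : ∀ j, u j ∈ f → f ∈ (G.incidenceFinset (u j)).erase s(v j, u j) := fun j hj => by
      rw [mem_erase, SimpleGraph.mem_incidenceFinset]
      exact ⟨fun heq => hfv j (heq ▸ by simp), hfG, hj⟩
    rw [mem_union]
    rcases hz' with hz' | hz'
    · left
      refine hmem i ?_
      rwa [← hthird i f z hfv hz hz']
    · right
      refine hmem (i + 1) ?_
      rwa [← hthird (i + 1) f z hfv hz hz']
  · have hcard : #((G.neighborFinset (u i)).erase (v i)) = 2 := by
      rw [card_erase_of_mem (by simpa using (hu.adj i).symm),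
        SimpleGraph.card_neighborFinset_eq_degree, hdeg]
    have := card_biUnion_incidence_le (fun v => (hdeg v).le) ((G.neighborFinset (u i)).erase (v i))
      {f ∈ G.edgeFinset | Conf G s(v i, u i) f ∧ ∀ s ∈ (range g).image v, s ∉ f} fun f hf => by
        rw [mem_filter, SimpleGraph.mem_edgeFinset, h.forall_notMem_iff] at hf
        obtain ⟨hfG, hconf, hfv⟩ := hf
        obtain ⟨z, hz, hz1, hz2, hz'⟩ := hconf.exists_neighbor (hu.adj i) hfG
        refine ⟨hfG, z, ?_, hz⟩
        rw [mem_erase, SimpleGraph.mem_neighborFinset]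
        exact ⟨hz1, hz'.resolve_left fun hadj => hz2 (hthird i f z hfv hz hadj)⟩
    rw [hcard] at this
    exact this

variable (h : IsShortestCycle G g v) (hu : IsThirdNeighbor G g v u) (hg : 7 ≤ g)
include h hu hg

lemma mem_cyclicStrip_of_conf {y z : ℕ} (hy : y < 2 * g) (hz : z < 2 * g)
    (hc : Conf G (stripEdge v u y) (stripEdge v u z)) :
    (y, z) ∈ cyclicStrip g ∨ (z, y) ∈ cyclicStrip g := by
  obtain ⟨hne, a, ha, b, hb, hab⟩ := hc
  have hyz : y ≠ z := fun heq => hne (by rw [heq])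
  suffices (y = z + 1 ∨ y = z + 2 ∨ y = z + 3 ∨ (y = z + 4 ∧ z % 2 = 1) ∨
      y + 2 * g = z + 1 ∨ y + 2 * g = z + 2 ∨ y + 2 * g = z + 3 ∨
      (y + 2 * g = z + 4 ∧ z % 2 = 1)) ∨ (z = y + 1 ∨ z = y + 2 ∨ z = y + 3 ∨
      (z = y + 4 ∧ y % 2 = 1) ∨ z + 2 * g = y + 1 ∨ z + 2 * g = y + 2 ∨ z + 2 * g = y + 3 ∨
      (z + 2 * g = y + 4 ∧ y % 2 = 1)) from
    this.imp (mem_cyclicStrip hg hy hz) (mem_cyclicStrip hg hz hy)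
  have hba : b = a ∨ G.Adj b a := hab.imp Eq.symm SimpleGraph.Adj.symm
  unfold stripEdge at ha hb
  split_ifs at ha hb with h1 h2 h2 <;> rw [Sym2.mem_iff] at ha hb <;>
    rcases ha with rfl | rfl <;> rcases hb with rfl | rfl
  all_goals first
    | (have := h.index_of_near (by omega) (by omega) hab; omega)
    | (have := h.index_of_near_third hu hg (by omega) (by omega) hab; omega)
    | (have := h.index_of_near_third hu hg (by omega) (by omega) hba; omega)
    | (have := h.thirdNeighbor_eq hu hg (by omega) (by omega) hab; omega)

/-- A shortest cycle of length at least `7` serves as the root set: the edges that meet it form a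
cyclic strip, in which the cycle edges keep six colors and the others four. -/
lemma intChoosable [Fintype V] [DecidableEq V] [DecidableRel G.Adj] (hG : G.Connected)
    (hdeg : ∀ v, G.degree v = 3) : IntChoosable G := by
  refine intChoosable_of_root hG (fun v => (hdeg v).le) (S := (range g).image v)
    (image_nonempty.2 (nonempty_range_iff.2 (by omega))) fun L hL => ?_
  have hedge : ∀ y, stripEdge v u y ∈ G.edgeSet := fun y => by
    unfold stripEdge
    split_ifs
    · exact h.adj _
    · exact hu.adj _
  have hmeet : ∀ y < 2 * g, ∃ s ∈ (range g).image v, s ∈ stripEdge v u y := fun y hy => by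
    refine ⟨v (y / 2), mem_image_of_mem _ (mem_range.2 (by omega)), ?_⟩
    unfold stripEdge
    split_ifs <;> simp
  obtain ⟨x, hx, hxE⟩ := exists_coloring_cyclicStrip hg (fun y => L (stripEdge v u y))
    fun y hy => by
      have h1 := hL _ (hedge y) (hmeet y hy)
      have h2 := h.card_conf_stripEdge_le hu hdeg y
      split_ifs at h2 ⊢ <;> omega
  have hex : ∀ e ∈ G.edgeSet, (∃ s ∈ (range g).image v, s ∈ e) →
      ∃ y < 2 * g, stripEdge v u y = e := by
    rintro e he ⟨s, hs, hse⟩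
    obtain ⟨k, hk, rfl⟩ := mem_image.1 hs
    exact h.exists_stripEdge hu he (mem_range.1 hk) hse
  choose! idx hidx using hex
  refine ⟨fun e => x (idx e), fun e he heS => ?_⟩
  obtain ⟨hq, hqe⟩ := hidx e he heS
  refine ⟨by have := hx _ hq; rwa [hqe] at this, fun f hf hfS hconf => ?_⟩
  obtain ⟨hq', hqf⟩ := hidx f hf hfS
  rw [← hqe, ← hqf] at hconf
  rcases h.mem_cyclicStrip_of_conf hu hg hq hq' hconf with hm | hm
  · exact hxE _ hm
  · exact (hxE _ hm).symm

end IsShortestCycle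

/-- A connected graph of maximum degree at most `3` is strong `10`-edge-choosable. -/
theorem intChoosable_of_connected {V : Type u} [Fintype V] [DecidableEq V] {G : SimpleGraph V}
    [DecidableRel G.Adj] (hG : G.Connected) (hdeg : ∀ v, G.degree v ≤ 3) : IntChoosable G := by
  by_contra hbad
  have hcubic : ∀ v, G.degree v = 3 := fun v => by
    by_contra hv
    exact hbad (intChoosable_of_degree_lt hG hdeg (lt_of_le_of_ne (hdeg v) hv))
  obtain ⟨g, v, h⟩ := IsShortestCycle.exists_of_isCyclic (exists_isCyclic hG hcubic)
  rcases Nat.lt_or_ge g 7 with hg | hg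
  · have h3 := h.three_le
    interval_cases g
    · exact free_triangle hG hcubic hbad v (h.isInduced (by decide))
    · exact free_cycleFour hG hcubic hbad v (h.isInduced (by decide))
    · exact free_cycleFive hG hcubic hbad v (h.isInduced (by decide))
    · exact free_cycleSix hG hcubic hbad v (h.isInduced (by decide))
  · obtain ⟨u, hu⟩ := h.exists_isThirdNeighbor hcubic
    exact hbad (h.intChoosable hu hg hG hcubic)

/-! ### Arbitrary graphs and colors -/

/-- Integer lists suffice for connected graphs; components are colored separately. -/
theorem intChoosable_of_maxDegree {V : Type u} [Fintype V] {G : SimpleGraph V} [DecidableRel G.Adj]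
    (hdeg : ∀ v, G.degree v ≤ 3) : IntChoosable G := by
  classical
  intro L hL
  have hcomp : ∀ c : G.ConnectedComponent, IntChoosable c.toSimpleGraph := fun c => by
    refine intChoosable_of_connected c.connected_toSimpleGraph fun v => (le_trans ?_ (hdeg v))
    rw [← SimpleGraph.card_neighborFinset_eq_degree, ← SimpleGraph.card_neighborFinset_eq_degree]
    refine card_le_card_of_injOn Subtype.val (fun w hw => ?_) Subtype.val_injective.injOn
    rw [mem_coe, SimpleGraph.mem_neighborFinset] at hw ⊢
    exact hw
  have hcolor : ∀ c : G.ConnectedComponent, ∃ x : Sym2 c → ℤ, ∀ e ∈ c.toSimpleGraph.edgeSet,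
      x e ∈ L (Sym2.map Subtype.val e) ∧
        ∀ f ∈ c.toSimpleGraph.edgeSet, Conf c.toSimpleGraph e f → x e ≠ x f := fun c => by
    obtain ⟨x, hx⟩ := hcomp c (fun e => L (Sym2.map Subtype.val e)) fun e he => hL _ (by
      induction e with | h a b => exact he)
    exact ⟨x, fun e he => ⟨(hx e he trivial).1, fun f hf => (hx e he trivial).2 f hf trivial⟩⟩
  choose x hx using hcolor
  have hrep : ∀ (c : G.ConnectedComponent) (e : Sym2 V), e ∈ G.edgeSet → ∀ a ∈ e,
      G.connectedComponentMk a = c →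
      ∃ e' ∈ c.toSimpleGraph.edgeSet, Sym2.map Subtype.val e' = e := by
    rintro _ e he a ha rfl
    obtain ⟨b, rfl⟩ := Sym2.mem_iff_exists.1 ha
    have hab : G.Adj a b := he
    exact ⟨s(⟨a, rfl⟩, ⟨b, SimpleGraph.ConnectedComponent.sound hab.symm.reachable⟩), hab, rfl⟩
  let y : (c : G.ConnectedComponent) → Sym2 V → ℤ := fun c e =>
    if h : ∃ e' ∈ c.toSimpleGraph.edgeSet, Sym2.map Subtype.val e' = e then x c h.choose else 0
  have hy : ∀ c, ∀ e' ∈ c.toSimpleGraph.edgeSet, y c (Sym2.map Subtype.val e') = x c e' := by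
    intro c e' he'
    have h : ∃ f ∈ c.toSimpleGraph.edgeSet,
      Sym2.map Subtype.val f = Sym2.map Subtype.val e' := ⟨e', he', rfl⟩
    simp only [y, dif_pos h]
    rw [Sym2.map.injective Subtype.val_injective h.choose_spec.2]
  refine ⟨fun e => y (G.connectedComponentMk (Quot.out e).1) e, fun e he _ => ?_⟩
  have key : ∀ e ∈ G.edgeSet, ∀ a ∈ e,
      G.connectedComponentMk (Quot.out e).1 = G.connectedComponentMk a := by
    intro e he a ha
    have hout := Sym2.out_fst_mem e
    by_cases heq : (Quot.out e).1 = a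
    · rw [heq]
    · rw [(Sym2.mem_and_mem_iff heq).1 ⟨hout, ha⟩] at he
      exact SimpleGraph.ConnectedComponent.sound (SimpleGraph.Adj.reachable he)
  refine ⟨?_, fun f hf _ hconf => ?_⟩
  · obtain ⟨e', he', heq⟩ := hrep _ e he _ (Sym2.out_fst_mem e) rfl
    have := (hx _ e' he').1
    rw [← hy _ e' he', heq] at this
    exact this
  · obtain ⟨hne, a, ha, b, hb, hab⟩ := hconf
    have hcomp : G.connectedComponentMk b = G.connectedComponentMk a := by
      rcases hab with rfl | hab
      · rfl
      · exact SimpleGraph.ConnectedComponent.sound hab.symm.reachable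
    obtain ⟨e', he', rfl⟩ := hrep _ e he a ha rfl
    obtain ⟨f', hf', rfl⟩ := hrep _ f hf b hb hcomp
    simp only [key _ he a ha, key _ hf b hb, hcomp]
    rw [hy _ _ he', hy _ _ hf']
    refine (hx _ e' he').2 f' hf' ⟨fun h => hne (by rw [h]), ?_⟩
    obtain ⟨a', ha', haa⟩ := Sym2.mem_map.1 ha
    obtain ⟨b', hb', hbb⟩ := Sym2.mem_map.1 hb
    rw [← haa, ← hbb] at hab
    exact ⟨a', ha', b', hb', hab.imp Subtype.ext id⟩

/-- The conflicts of a strong edge-coloring in terms of the vertices of `G`. -/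
lemma conf_iff_edist_le_two {V : Type u} {G : SimpleGraph V} {e f : G.edgeSet} (hne : e ≠ f) :
    Conf G e f ↔ G.lineGraph.edist e f ≤ 2 := by
  have hshare : ∀ e f : G.edgeSet, e ≠ f → ∀ a, a ∈ (e : Sym2 V) → a ∈ (f : Sym2 V) →
      G.lineGraph.Adj e f := fun e f h a h1 h2 =>
    SimpleGraph.lineGraph_adj_iff_exists.2 ⟨h, a, h1, h2⟩
  have hval : (e : Sym2 V) ≠ f := fun h => hne (Subtype.ext h)
  rw [← not_lt, SimpleGraph.two_lt_edist_iff]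
  constructor
  · rintro ⟨-, a, ha, b, hb, rfl | hab⟩ ⟨-, hadj, hempty⟩
    · exact hadj (hshare e f hne a ha hb)
    · by_cases he : e = ⟨s(a, b), hab⟩
      · exact hadj (hshare e f hne b (by rw [he]; simp) hb)
      by_cases hf : f = ⟨s(a, b), hab⟩
      · exact hadj (hshare e f hne a ha (by rw [hf]; simp))
      have : (⟨s(a, b), hab⟩ : G.edgeSet) ∈ G.lineGraph.commonNeighbors e f :=
        ⟨hshare _ _ he a ha (by simp), hshare _ _ hf b hb (by simp)⟩
      rw [hempty] at this
      exact this
  · intro h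
    have h : G.lineGraph.Adj e f ∨ (G.lineGraph.commonNeighbors e f).Nonempty := by
      by_contra! hcon
      exact h ⟨hne, hcon.1, hcon.2⟩
    refine ⟨hval, ?_⟩
    rcases h with h | ⟨m, hem, hfm⟩
    · obtain ⟨-, a, ha, hb⟩ := SimpleGraph.lineGraph_adj_iff_exists.1 h
      exact ⟨a, ha, a, hb, Or.inl rfl⟩
    · obtain ⟨-, a, ha, ham⟩ := SimpleGraph.lineGraph_adj_iff_exists.1 hem
      obtain ⟨-, b, hb, hbm⟩ := SimpleGraph.lineGraph_adj_iff_exists.1 hfm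
      refine ⟨a, ha, b, hb, or_iff_not_imp_left.2 fun hab => ?_⟩
      have := m.2
      rwa [(Sym2.mem_and_mem_iff hab).1 ⟨ham, hbm⟩] at this

/-- Lists of ten colors of any kind contain lists of ten integers, as only finitely many colors are
needed. -/
theorem strongEdgeChoosable_ten {V : Type u} [Fintype V] {G : SimpleGraph V} [DecidableRel G.Adj]
    (hdeg : G.maxDegree ≤ 3) : SimpleGraph.StrongEdgeChoosable.{u, v} G 10 := by
  classical
  intro C L hL
  choose T hTL hT using fun e => Set.exists_subset_encard_eq (hL e)
  have hfin : ∀ e, (T e).Finite := fun e =>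
    Set.finite_of_encard_eq_coe (hT e)
  obtain ⟨f, hf⟩ := Set.countable_iff_exists_injOn.1 (Set.finite_iUnion hfin).countable
  let code : C → ℤ := fun c => f c
  have hcode : ∀ e, Set.InjOn code (T e) := fun e a ha b hb hab =>
    hf (Set.mem_iUnion_of_mem e ha) (Set.mem_iUnion_of_mem e hb) (Int.ofNat_inj.1 hab)
  let L' : Sym2 V → Finset ℤ := fun e =>
    if h : e ∈ G.edgeSet then (hfin ⟨e, h⟩).toFinset.image code else ∅
  have hL' : ∀ e : G.edgeSet, L' e = (hfin e).toFinset.image code := fun e => dif_pos e.2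
  obtain ⟨x, hx⟩ := intChoosable_of_maxDegree (fun v => (G.degree_le_maxDegree v).trans hdeg) L'
    fun e he => by
      rw [hL' ⟨e, he⟩, card_image_of_injOn (by simpa using hcode _)]
      have := hT ⟨e, he⟩
      rw [(hfin ⟨e, he⟩).encard_eq_coe_toFinset_card] at this
      exact_mod_cast this.ge
  have hcolor : ∀ e : G.edgeSet, ∃ c ∈ T e, code c = x e := fun e => by
    have := (hx e e.2 trivial).1
    rw [hL', mem_image] at this
    simpa using this
  choose φ hφT hφ using hcolor
  refine ⟨φ, fun e f hne hdist heq => ?_, fun e => hTL e (hφT e)⟩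
  refine (hx e e.2 trivial).2 f f.2 trivial ((conf_iff_edist_le_two hne).2 hdist) ?_
  rw [← hφ, ← hφ, heq]

/-! ### A graph that needs ten colors -/

/-- The edges of the `5`-cycle with two adjacent vertices doubled. -/
def blowupEdges : List (ℕ × ℕ) :=
  [(0, 2), (0, 3), (1, 2), (1, 3), (2, 4), (3, 4), (4, 5), (5, 6), (6, 0), (6, 1)]

/-- The `5`-cycle with two adjacent vertices doubled. Any two of its ten edges conflict. -/
def blowup : SimpleGraph (Fin 7) where
  Adj a b := adjOf blowupEdges a b = true
  symm := ⟨fun a b h => by rwa [adjOf_comm]⟩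
  loopless := ⟨by decide⟩

instance : DecidableRel blowup.Adj := fun a b =>
  inferInstanceAs (Decidable (adjOf blowupEdges a b = true))

lemma ten_le_of_strongEdgeChoosable_blowup {k : ℕ}
    (hk : SimpleGraph.StrongEdgeChoosable.{0, v} blowup k) : 10 ≤ k := by
  by_contra! hlt
  obtain ⟨φ, hφ, -⟩ := hk (ULift.{v} (Fin 9)) (fun _ => Set.univ) fun e => by
    rw [Set.encard_univ, ENat.card_eq_coe_fintype_card, Fintype.card_ulift, Fintype.card_fin]
    exact_mod_cast Nat.le_of_lt_succ hlt
  have hinj : Function.Injective φ := by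
    intro e f heq
    by_contra hne
    refine hφ e f hne ((conf_iff_edist_le_two hne).1 ?_) heq
    have key : ∀ a b c d : Fin 7, blowup.Adj a b → blowup.Adj c d → (a = c ∨ blowup.Adj a c) ∨
        (a = d ∨ blowup.Adj a d) ∨ (b = c ∨ blowup.Adj b c) ∨ (b = d ∨ blowup.Adj b d) := by
      decide +kernel
    obtain ⟨e, he⟩ := e
    obtain ⟨f, hf⟩ := f
    refine ⟨fun h => hne (Subtype.ext h), ?_⟩
    induction e with | h a b => ?_
    induction f with | h c d => ?_
    rcases key a b c d he hf with h | h | h | h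
    · exact ⟨a, by simp, c, by simp, h⟩
    · exact ⟨a, by simp, d, by simp, h⟩
    · exact ⟨b, by simp, c, by simp, h⟩
    · exact ⟨b, by simp, d, by simp, h⟩
  have hcard : Fintype.card blowup.edgeSet = 10 := by
    rw [← SimpleGraph.edgeFinset_card]
    decide +kernel
  have := Fintype.card_le_of_injective φ hinj
  rw [hcard, Fintype.card_ulift, Fintype.card_fin] at this
  omega

end StrongEdge

theorem theorem1p3 :
    (∀ (V : Type u) [Fintype V] (G : SimpleGraph V) [DecidableRel G.Adj], G.maxDegree ≤ 3 →
      SimpleGraph.listStrongChromaticIndex.{u, v} G ≤ 10 ∧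
        SimpleGraph.StrongEdgeChoosable.{u, v} G 10) ∧
    (∃ (n : ℕ) (H : SimpleGraph (Fin n)) (_ : DecidableRel H.Adj), H.maxDegree ≤ 3 ∧
      SimpleGraph.listStrongChromaticIndex.{0, v} H = 10) := by
  have hmax : StrongEdge.blowup.maxDegree ≤ 3 :=
    SimpleGraph.maxDegree_le_of_forall_degree_le _ 3 (by decide +kernel)
  refine ⟨fun V _ G _ hG => ?_, 7, StrongEdge.blowup, inferInstance, hmax, le_antisymm ?_ ?_⟩
  · have h := StrongEdge.strongEdgeChoosable_ten.{u, v} hG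
    exact ⟨iInf₂_le 10 h, h⟩
  · exact iInf₂_le 10 (StrongEdge.strongEdgeChoosable_ten.{0, v} hmax)
  · refine le_iInf₂ fun k hk => ?_
    exact_mod_cast StrongEdge.ten_le_of_strongEdgeChoosable_blowup hk
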